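/- Let $K$ be a field, $n\ge 1$ an integer, and $A=K\langle a_1,\dots,a_n\rangle$ the free unital associative $K$-algebra of rank $n$. The right ideals $I$ of $A$ with $\dim_K A/I<\infty$ form a Gabriel topology $\mathfrak F$ on $A$; let $Q=Q^{fc}_K(n)=\varinjlim_{I\in\mathfrak F}\operatorname{Hom}_A(I_A,A_A)$ be the corresponding ring of right quotients (the fc-localization of $A$; no nonzero element of $A$ is annihilated by a member of $\mathfrak F$), with canonical map $\varphi:A\to Q$, where $a$ goes to left multiplication by $a$. Call a ring homomorphism $\psi:A\to B$ a perfect right localization if it is an epimorphism of rings and $B$ is flat as a left $A$-module, and a flat bimorphism if moreover it is injective. Let $Q_{\max}(A)$ be the maximal ring of right quotients of $A$ (the ring of right quotients with respect to all dense right ideals), and let $Q^r_{tot}(A)$ be the largest subring $T\supseteq A$ of $Q_{\max}(A)$ such that $A\to T$ is a flat bimorphism. Then: 1. $\varphi$ is a perfect right localization, and it is injective, so it is a flat bimorphism. 2. $Q$ is the largest flat bimorphic ring of right quotients of $A$: for every flat bimorphism $\psi:A\to B$ there is exactly one ring homomorphism $h:B\to Q$ with $h\psi=\varphi$, and $h$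 is injective; moreover there is an injective ring homomorphism $Q\to Q_{\max}(A)$ over $A$ whose image is $Q^r_{tot}(A)$ (in particular $Q^r_{tot}(A)$ exists). 3. $Q$ is a simple ring, and it is projective-free: every projective right $Q$-module and every projective left $Q$-module is free. 4. If $n=1$, then $Q$ has IBN (free right $Q$-modules of different finite ranks are not isomorphic), and $K_0(Q)\cong\mathbb Z$. 5. If $n>1$, then $Q$ has module type $(1,n)$, that is, $Q\cong Q^n$ as right modules, and $Q^h\cong Q^k$ with $1\le h<k$ implies $k\ge n$; and $K_0(Q)\cong\mathbb Z/(n-1)\mathbb Z$ is cyclic of order $n-1$. Here $K_0(Q)$ is the Grothendieck group of the finitely generated projective right $Q$-modules. -/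

import Mathlib

open MulOpposite
open scoped TensorProduct

universe u v w

namespace RightLoc

/-! Right ideals of a ring `A` are the left ideals of `Aᵐᵒᵖ`: `a` belongs to the right ideal
`I : Ideal Aᵐᵒᵖ` when `op a ∈ I`. Right `A`-modules are the modules over `Aᵐᵒᵖ`. A Gabriel topology
of right ideals of `A` is an `F : IdealFilter Aᵐᵒᵖ` with `F.IsGabriel`. -/

/-! ### Rings of right quotients -/

section Quotients

variable {A : Type u} [Ring A]

/-- A homomorphism of right modules `I → A` whose domain `I` belongs to `F`. It is stored as a
function on all of `A`; its values outside `I` are irrelevant (see `PartialHom.setoid`). -/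
structure PartialHom (F : IdealFilter Aᵐᵒᵖ) where
  toFun : A → A
  dom : Ideal Aᵐᵒᵖ
  dom_mem : dom ∈ F
  map_add : ∀ x y : A, op x ∈ dom → op y ∈ dom → toFun (x + y) = toFun x + toFun y
  map_mul : ∀ x r : A, op x ∈ dom → toFun (x * r) = toFun x * r

variable (F : IdealFilter Aᵐᵒᵖ)

/-- Two partial homomorphisms are identified when they agree on some member of `F`. -/
def PartialHom.setoid : Setoid (PartialHom F) where
  r f g := ∃ J ∈ F, ∀ x : A, op x ∈ J → f.toFun x = g.toFun x
  iseqv :=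
    { refl := fun f => ⟨f.dom, f.dom_mem, fun _ _ => rfl⟩
      symm := fun ⟨J, hJ, h⟩ => ⟨J, hJ, fun x hx => (h x hx).symm⟩
      trans := fun ⟨J, hJ, h⟩ ⟨J', hJ', h'⟩ =>
        ⟨J ⊓ J', Order.PFilter.inf_mem hJ hJ', fun x hx => (h x hx.1).trans (h' x hx.2)⟩ }

/-- The direct limit of the groups `Hom(I, A)` of right module homomorphisms over `I ∈ F`.
If no nonzero element of `A` is annihilated by a member of the Gabriel topology `F`, this is the
ring of right quotients of `A` with respect to `F` (in general one has to replace the target `A`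
by its quotient modulo the `F`-torsion elements). -/
def RightQuotients : Type u := Quotient (PartialHom.setoid F)

namespace PartialHom

variable {F}

/-- Left multiplication by an element of `A`, defined on all of `A`. -/
def ofElem (a : A) : PartialHom F where
  toFun x := a * x
  dom := ⊤
  dom_mem := Order.PFilter.top_mem
  map_add x y _ _ := mul_add a x y
  map_mul x r _ := (mul_assoc a x r).symm

/-- The sum, defined on the intersection of the domains. -/
def add (f g : PartialHom F) : PartialHom F where
  toFun x := f.toFun x + g.toFun x
  dom := f.dom ⊓ g.dom
  dom_mem := Order.PFilter.inf_mem f.dom_mem g.dom_mem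
  map_add x y hx hy := by rw [f.map_add x y hx.1 hy.1, g.map_add x y hx.2 hy.2]; abel
  map_mul x r hx := by rw [f.map_mul x r hx.1, g.map_mul x r hx.2, add_mul]

/-- The negative. -/
def neg (f : PartialHom F) : PartialHom F where
  toFun x := -f.toFun x
  dom := f.dom
  dom_mem := f.dom_mem
  map_add x y hx hy := by rw [f.map_add x y hx hy, neg_add]
  map_mul x r hx := by rw [f.map_mul x r hx, neg_mul]

theorem map_zero (f : PartialHom F) : f.toFun 0 = 0 := by
  have := f.map_mul 0 0 (by simp)
  simpa using this

/-- The right ideal of those `x` in the domain of `g` with `g x ∈ I`. -/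
def preimage (g : PartialHom F) (I : Ideal Aᵐᵒᵖ) : Ideal Aᵐᵒᵖ where
  carrier := {s | s ∈ g.dom ∧ op (g.toFun s.unop) ∈ I}
  add_mem' := by
    rintro s t ⟨hs, hs'⟩ ⟨ht, ht'⟩
    refine ⟨add_mem hs ht, ?_⟩
    rw [unop_add, g.map_add s.unop t.unop hs ht, op_add]
    exact add_mem hs' ht'
  zero_mem' := ⟨zero_mem _, by rw [unop_zero, g.map_zero]; exact zero_mem _⟩
  smul_mem' := by
    rintro c s ⟨hs, hs'⟩
    refine ⟨Ideal.mul_mem_left _ c hs, ?_⟩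
    rw [smul_eq_mul, unop_mul, g.map_mul s.unop c.unop hs, op_mul]
    exact Ideal.mul_mem_left _ _ hs'

theorem preimage_mem [F.IsGabriel] (g : PartialHom F) {I : Ideal Aᵐᵒᵖ} (hI : I ∈ F) :
    g.preimage I ∈ F := by
  refine IdealFilter.IsGabriel.gabriel_closed _ ⟨g.dom, g.dom_mem, fun s hs => ?_⟩
  refine Order.PFilter.mem_of_le ?_
    (IdealFilter.IsUniform.colon_mem hI (op (g.toFun s.unop)))
  intro t ht
  rw [Submodule.mem_colon_singleton] at ht ⊢
  refine ⟨Ideal.mul_mem_left _ t hs, ?_⟩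
  rw [smul_eq_mul, unop_mul, g.map_mul s.unop t.unop hs, op_mul]
  exact ht

/-- The composite `f ∘ g`, defined where it makes sense. -/
def comp [F.IsGabriel] (f g : PartialHom F) : PartialHom F where
  toFun x := f.toFun (g.toFun x)
  dom := g.preimage f.dom
  dom_mem := g.preimage_mem f.dom_mem
  map_add x y hx hy := by rw [g.map_add x y hx.1 hy.1, f.map_add (g.toFun x) (g.toFun y) hx.2 hy.2]
  map_mul x r hx := by rw [g.map_mul x r hx.1, f.map_mul (g.toFun x) r hx.2]

end PartialHom

namespace RightQuotients

/-- Addition is induced by pointwise addition. -/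
instance instAdd : Add (RightQuotients F) where
  add := Quotient.map₂ PartialHom.add (by
    rintro f f' ⟨J, hJ, h⟩ g g' ⟨J', hJ', h'⟩
    exact ⟨J ⊓ J', Order.PFilter.inf_mem hJ hJ', fun x hx =>
      congrArg₂ (· + ·) (h x hx.1) (h' x hx.2)⟩)

instance instNeg : Neg (RightQuotients F) where
  neg := Quotient.map PartialHom.neg (by
    rintro f f' ⟨J, hJ, h⟩
    exact ⟨J, hJ, fun x hx => congrArg Neg.neg (h x hx)⟩)

/-- Multiplication is induced by composition. -/
instance instMul [F.IsGabriel] : Mul (RightQuotients F) where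
  mul := Quotient.map₂ PartialHom.comp (by
    rintro f f' ⟨J, hJ, h⟩ g g' ⟨J', hJ', h'⟩
    refine ⟨g.preimage J ⊓ J', Order.PFilter.inf_mem (g.preimage_mem hJ) hJ', fun x hx => ?_⟩
    exact (h _ hx.1.2).trans (congrArg f'.toFun (h' x hx.2)))

instance instZero : Zero (RightQuotients F) where
  zero := Quotient.mk _ (PartialHom.ofElem 0)

instance instOne : One (RightQuotients F) where
  one := Quotient.mk _ (PartialHom.ofElem 1)

instance instRing [F.IsGabriel] : Ring (RightQuotients F) where
  nsmul := nsmulRec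
  zsmul := zsmulRec
  add_assoc := by
    rintro ⟨f⟩ ⟨g⟩ ⟨h⟩
    exact Quotient.sound ⟨⊤, Order.PFilter.top_mem, fun x _ => add_assoc _ _ _⟩
  add_comm := by
    rintro ⟨f⟩ ⟨g⟩
    exact Quotient.sound ⟨⊤, Order.PFilter.top_mem, fun x _ => add_comm _ _⟩
  zero_add := by
    rintro ⟨f⟩
    exact Quotient.sound ⟨⊤, Order.PFilter.top_mem, fun x _ =>
      show 0 * x + f.toFun x = f.toFun x by simp⟩
  add_zero := by
    rintro ⟨f⟩
    exact Quotient.sound ⟨⊤, Order.PFilter.top_mem, fun x _ =>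
      show f.toFun x + 0 * x = f.toFun x by simp⟩
  neg_add_cancel := by
    rintro ⟨f⟩
    exact Quotient.sound ⟨⊤, Order.PFilter.top_mem, fun x _ =>
      show -f.toFun x + f.toFun x = 0 * x by simp⟩
  mul_assoc := by
    rintro ⟨f⟩ ⟨g⟩ ⟨h⟩
    exact Quotient.sound ⟨⊤, Order.PFilter.top_mem, fun x _ => rfl⟩
  one_mul := by
    rintro ⟨f⟩
    exact Quotient.sound ⟨⊤, Order.PFilter.top_mem, fun x _ => one_mul _⟩
  mul_one := by
    rintro ⟨f⟩
    exact Quotient.sound ⟨⊤, Order.PFilter.top_mem, fun x _ =>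
      congrArg f.toFun (one_mul x)⟩
  zero_mul := by
    rintro ⟨f⟩
    exact Quotient.sound ⟨⊤, Order.PFilter.top_mem, fun x _ =>
      show 0 * f.toFun x = 0 * x by simp⟩
  mul_zero := by
    rintro ⟨f⟩
    exact Quotient.sound ⟨⊤, Order.PFilter.top_mem, fun x _ =>
      show f.toFun (0 * x) = 0 * x by simp [f.map_zero]⟩
  left_distrib := by
    rintro ⟨f⟩ ⟨g⟩ ⟨h⟩
    exact Quotient.sound ⟨g.preimage f.dom ⊓ h.preimage f.dom,
      Order.PFilter.inf_mem (g.preimage_mem f.dom_mem) (h.preimage_mem f.dom_mem),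
      fun x hx => f.map_add _ _ hx.1.2 hx.2.2⟩
  right_distrib := by
    rintro ⟨f⟩ ⟨g⟩ ⟨h⟩
    exact Quotient.sound ⟨⊤, Order.PFilter.top_mem, fun x _ => rfl⟩

/-- The canonical ring homomorphism from `A`, sending `a` to left multiplication by `a`. -/
def ofRing [F.IsGabriel] : A →+* RightQuotients F where
  toFun a := Quotient.mk _ (PartialHom.ofElem a)
  map_one' := rfl
  map_zero' := rfl
  map_mul' a b := Quotient.sound ⟨⊤, Order.PFilter.top_mem, fun x _ => mul_assoc a b x⟩
  map_add' a b := Quotient.sound ⟨⊤, Order.PFilter.top_mem, fun x _ => add_mul a b x⟩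

end RightQuotients

end Quotients

/-! ### The topology of finite codimensional right ideals -/

section FC

variable (K : Type u) [Field K]

/-- The filter of the right ideals `I` of `A` with `dim_K (A / I) < ∞`. -/
def fcFilter (A : Type v) [Ring A] [Algebra K A] : IdealFilter Aᵐᵒᵖ :=
  Order.IsPFilter.toPFilter (F := {I : Ideal Aᵐᵒᵖ | (I.restrictScalars K).CoFG}) <| by
    refine Order.IsPFilter.of_def ⟨⊤, ?_⟩ ?_ ?_
    · rw [Set.mem_ofPred_eq, Submodule.restrictScalars_top]
      infer_instance
    · intro I hI J hJ
      refine ⟨I ⊓ J, ?_, inf_le_left, inf_le_right⟩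
      rw [Set.mem_ofPred_eq] at hI hJ ⊢
      rw [Submodule.restrictScalars_inf]
      exact hI.inf hJ
    · intro I J hIJ hI
      exact Submodule.CoFG.of_le (S := I.restrictScalars K) hIJ hI

variable {K}

theorem mem_fcFilter {A : Type v} [Ring A] [Algebra K A] {I : Ideal Aᵐᵒᵖ} :
    I ∈ fcFilter K A ↔ (I.restrictScalars K).CoFG := Iff.rfl

theorem exists_fg_sup_eq_top {V : Type v} [AddCommGroup V] [Module K V] {S : Submodule K V}
    (hS : S.CoFG) : ∃ W : Submodule K V, W.FG ∧ W ⊔ S = ⊤ := by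
  obtain ⟨W, hW⟩ := S.exists_isCompl
  exact ⟨W, Submodule.CoFG.fg_of_isCompl hW hS, hW.symm.sup_eq_top⟩

theorem fg_of_finite_codim {B : Type v} [Ring B] [Algebra K B]
    {s : Set B} (hs : s.Finite) (hst : Algebra.adjoin K s = ⊤) {J : Ideal B}
    (hJ : (J.restrictScalars K).CoFG) : J.FG := by
  obtain ⟨V₀, hV₀, hVJ₀⟩ := exists_fg_sup_eq_top hJ
  set V := V₀ ⊔ Submodule.span K {(1 : B)} with hVdef
  have hV : V.FG := hV₀.sup (Submodule.fg_span_singleton _)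
  have h1V : (1 : B) ∈ V := le_sup_right (a := V₀) (Submodule.mem_span_singleton_self _)
  have hVJ : V ⊔ J.restrictScalars K = ⊤ :=
    top_le_iff.mp (hVJ₀ ▸ sup_le_sup_right le_sup_left _)
  set W := V ⊔ Submodule.span K s * V with hWdef
  have hW : W.FG := hV.sup ((Submodule.fg_span hs).mul hV)
  have hWJ : (W ⊓ J.restrictScalars K).FG := by
    have : Module.Finite K W := Module.Finite.iff_fg.mpr hW
    exact Submodule.FG.of_le hW inf_le_left
  obtain ⟨t, ht⟩ := hWJ
  refine ⟨t, le_antisymm (Submodule.span_le.mpr ?_) ?_⟩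
  · intro x hx
    have : x ∈ W ⊓ J.restrictScalars K := ht ▸ Submodule.subset_span hx
    exact this.2
  set J' : Ideal B := Submodule.span B (t : Set B) with hJ'
  have hsub : W ⊓ J.restrictScalars K ≤ J'.restrictScalars K := by
    rw [← ht]
    exact Submodule.span_le.mpr fun x hx => Submodule.subset_span hx
  have hT : ∀ b : B, ∀ y ∈ V ⊔ J'.restrictScalars K, b * y ∈ V ⊔ J'.restrictScalars K := by
    intro b
    have hb : b ∈ Algebra.adjoin K s := hst ▸ Algebra.mem_top
    induction hb using Algebra.adjoin_induction with
    | mem x hx =>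
      intro y hy
      obtain ⟨v, hv, j, hj, rfl⟩ := Submodule.mem_sup.mp hy
      rw [mul_add]
      refine add_mem ?_ (Submodule.mem_sup_right (Ideal.mul_mem_left J' x hj))
      obtain ⟨v', hv', j', hj', e⟩ :=
        Submodule.mem_sup.mp (show x * v ∈ V ⊔ J.restrictScalars K from hVJ ▸ trivial)
      rw [← e]
      refine add_mem (Submodule.mem_sup_left hv') (Submodule.mem_sup_right (hsub ⟨?_, hj'⟩))
      have : j' = x * v - v' := by rw [← e]; abel
      rw [this]
      exact sub_mem (Submodule.mem_sup_right
        (Submodule.mul_mem_mul (Submodule.subset_span hx) hv)) (Submodule.mem_sup_left hv')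
    | algebraMap r =>
      intro y hy
      rw [← Algebra.smul_def]
      exact Submodule.smul_mem _ r hy
    | add x y _ _ hx hy =>
      intro z hz
      rw [add_mul]
      exact add_mem (hx z hz) (hy z hz)
    | mul x y _ _ hx hy =>
      intro z hz
      rw [mul_assoc]
      exact hx _ (hy z hz)
  intro j hj
  have hjT : j ∈ V ⊔ J'.restrictScalars K := by
    simpa using hT j 1 (Submodule.mem_sup_left h1V)
  obtain ⟨v, hv, j', hj', rfl⟩ := Submodule.mem_sup.mp hjT
  have hj'J : j' ∈ J := by
    have : J' ≤ J := Submodule.span_le.mpr fun x hx =>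
      (ht ▸ Submodule.subset_span hx : x ∈ W ⊓ J.restrictScalars K).2
    exact this hj'
  refine add_mem (hsub ⟨Submodule.mem_sup_left hv, ?_⟩) hj'
  have : v = (v + j') - j' := by abel
  rw [this]
  exact J.sub_mem hj hj'J

/-- The finite codimensional right ideals of a free algebra of finite rank are a Gabriel
topology. -/
instance fcFilter_isGabriel (K : Type u) [Field K] (n : ℕ) :
    (fcFilter K (FreeAlgebra K (Fin n))).IsGabriel where
  colon_mem {I} hI a := by
    rw [mem_fcFilter] at hI ⊢
    let f := (I.restrictScalars K).mkQ ∘ₗ LinearMap.mulRight K a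
    have : (I.colon {a}).restrictScalars K = LinearMap.ker f := by
      ext x
      simp [f, Submodule.mem_colon_singleton]
    rw [this]
    have := hI
    exact Submodule.CoFG.ker f
  gabriel_closed I := by
    rintro ⟨J, hJ, h⟩
    rw [mem_fcFilter] at hJ ⊢
    have hJfg : J.FG := by
      refine fg_of_finite_codim (K := K)
        (s := MulOpposite.unop ⁻¹' Set.range (FreeAlgebra.ι K : Fin n → _)) ?_ ?_ hJ
      · exact (Set.finite_range _).preimage unop_injective.injOn
      · rw [← Subalgebra.op_adjoin, FreeAlgebra.adjoin_range_ι, Subalgebra.op_top]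
    obtain ⟨t, ht⟩ := hJfg
    obtain ⟨V, hV, hVJ⟩ := exists_fg_sup_eq_top hJ
    have hc : ∀ x : t, ∃ W : Submodule K (FreeAlgebra K (Fin n))ᵐᵒᵖ, W.FG ∧
        W ⊔ (I.colon {x.1}).restrictScalars K = ⊤ := fun x =>
      exists_fg_sup_eq_top (mem_fcFilter.mp (h x.1 (ht ▸ Submodule.subset_span x.2)))
    choose W hW hWI using hc
    let U := V ⊔ ⨆ x : t, (W x).map (LinearMap.mulRight K x.1)
    have hU : U.FG := hV.sup (Submodule.fg_iSup _ fun x => (hW x).map _)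
    refine Submodule.FG.cofg_of_codisjoint (S := U) ?_ hU
    have key : J.restrictScalars K ≤ U ⊔ I.restrictScalars K := by
      intro j hj
      have hj : j ∈ Submodule.span _ (t : Set (FreeAlgebra K (Fin n))ᵐᵒᵖ) := ht ▸ hj
      obtain ⟨b, -, rfl⟩ := Submodule.mem_span_finset.mp hj
      refine sum_mem fun x hx => ?_
      obtain ⟨w, hw, c, hc, e⟩ := Submodule.mem_sup.mp
        (show b x ∈ W ⟨x, hx⟩ ⊔ (I.colon {x}).restrictScalars K from hWI ⟨x, hx⟩ ▸ trivial)
      rw [← e, add_smul]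
      refine add_mem (Submodule.mem_sup_left (Submodule.mem_sup_right ?_))
        (Submodule.mem_sup_right (Submodule.mem_colon_singleton.mp hc))
      exact Submodule.mem_iSup_of_mem (⟨x, hx⟩ : t) ⟨w, hw, rfl⟩
    rw [codisjoint_iff, ← top_le_iff, ← hVJ]
    exact sup_le (le_sup_left.trans le_sup_left) key

end FC

/-- The localization of the free algebra `K⟨a₁, …, aₙ⟩` with respect to the topology of all finite
codimensional right ideals. -/
abbrev Qfc (K : Type u) [Field K] (n : ℕ) : Type u :=
  RightQuotients (fcFilter K (FreeAlgebra K (Fin n)))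

/-- The canonical homomorphism from the free algebra to its fc-localization. -/
abbrev toQfc (K : Type u) [Field K] (n : ℕ) : FreeAlgebra K (Fin n) →+* Qfc K n :=
  RightQuotients.ofRing (fcFilter K (FreeAlgebra K (Fin n)))

/-! ### The maximal ring of right quotients -/

section Max

variable (A : Type u) [Ring A]

/-- A right ideal `D` is dense if for all `a, b` with `b ≠ 0` there is an `r` such that `a * r ∈ D`
and `b * r ≠ 0`. -/
def IsDenseRightIdeal {A : Type u} [Ring A] (D : Ideal Aᵐᵒᵖ) : Prop :=
  ∀ a b : A, b ≠ 0 → ∃ r : A, op (a * r) ∈ D ∧ b * r ≠ 0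

/-- The filter of the dense right ideals. -/
def denseFilter : IdealFilter Aᵐᵒᵖ :=
  Order.IsPFilter.toPFilter (F := {D : Ideal Aᵐᵒᵖ | IsDenseRightIdeal D}) <| by
    refine Order.IsPFilter.of_def ⟨⊤, ?_⟩ ?_ ?_
    · intro a b hb
      exact ⟨1, trivial, by simpa using hb⟩
    · intro I hI J hJ
      refine ⟨I ⊓ J, ?_, inf_le_left, inf_le_right⟩
      intro a b hb
      obtain ⟨r, hr, hbr⟩ := hI a b hb
      obtain ⟨s, hs, hbs⟩ := hJ (a * r) (b * r) hbr
      refine ⟨r * s, ⟨?_, ?_⟩, by rwa [← mul_assoc]⟩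
      · rw [← mul_assoc, op_mul]
        exact I.mul_mem_left _ hr
      · rwa [← mul_assoc]
    · intro I J hIJ hI a b hb
      obtain ⟨r, hr, hbr⟩ := hI a b hb
      exact ⟨r, hIJ hr, hbr⟩

theorem mem_denseFilter {A : Type u} [Ring A] {D : Ideal Aᵐᵒᵖ} :
    D ∈ denseFilter A ↔ IsDenseRightIdeal D := Iff.rfl

instance denseFilter_isGabriel : (denseFilter A).IsGabriel where
  colon_mem {I} hI c := by
    intro a b hb
    obtain ⟨r, hr, hbr⟩ := hI (c.unop * a) b hb
    refine ⟨r, ?_, hbr⟩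
    rw [mul_assoc] at hr
    exact Submodule.mem_colon_singleton.mpr hr
  gabriel_closed I := by
    rintro ⟨J, hJ, h⟩ a b hb
    obtain ⟨r, hr, hbr⟩ := hJ a b hb
    obtain ⟨s, hs, hbs⟩ := h _ hr 1 (b * r) hbr
    refine ⟨r * s, ?_, by rwa [← mul_assoc]⟩
    rw [one_mul] at hs
    rw [← mul_assoc, op_mul]
    exact Submodule.mem_colon_singleton.mp hs

/-- The maximal ring of right quotients `Q_max(A)`. -/
abbrev Qmax : Type u := RightQuotients (denseFilter A)

/-- The canonical homomorphism `A → Q_max(A)`. -/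
abbrev toQmax : A →+* Qmax A := RightQuotients.ofRing (denseFilter A)

end Max

/-! ### Flat epimorphisms of rings -/

section Flat

/-- The relations `n a ⊗ m = n ⊗ a m`. -/
def balancedRelations (A : Type u) [Ring A] (N : Type w) [AddCommGroup N] [Module Aᵐᵒᵖ N]
    (M : Type v) [AddCommGroup M] [Module A M] : AddSubgroup (N ⊗[ℤ] M) :=
  AddSubgroup.closure
    {z | ∃ (n : N) (a : A) (m : M), z = (op a • n) ⊗ₜ[ℤ] m - n ⊗ₜ[ℤ] (a • m)}

/-- The tensor product `N ⊗_A M` of a right `A`-module `N` and a left `A`-module `M`. -/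
abbrev BalancedTensor (A : Type u) [Ring A] (N : Type w) [AddCommGroup N] [Module Aᵐᵒᵖ N]
    (M : Type v) [AddCommGroup M] [Module A M] : Type (max v w) :=
  (N ⊗[ℤ] M) ⧸ balancedRelations A N M

/-- The map `f ⊗ id : N ⊗_A M → N' ⊗_A M`. -/
def BalancedTensor.map {A : Type u} [Ring A] {N N' : Type w} [AddCommGroup N] [Module Aᵐᵒᵖ N]
    [AddCommGroup N'] [Module Aᵐᵒᵖ N'] (f : N →ₗ[Aᵐᵒᵖ] N')
    (M : Type v) [AddCommGroup M] [Module A M] :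
    BalancedTensor A N M →+ BalancedTensor A N' M :=
  QuotientAddGroup.map _ _
    (LinearMap.rTensor M f.toAddMonoidHom.toIntLinearMap).toAddMonoidHom <| by
    refine (AddSubgroup.closure_le _).mpr ?_
    rintro _ ⟨n, a, m, rfl⟩
    refine AddSubgroup.subset_closure ⟨f n, a, m, ?_⟩
    rw [map_sub]
    exact congrArg (fun y => y ⊗ₜ[ℤ] m - f n ⊗ₜ[ℤ] (a • m)) (f.map_smul (op a) n)

/-- A left `A`-module `M` is flat if `- ⊗_A M` preserves injectivity of maps of right modules. -/
def IsFlatLeftModule (A : Type u) [Ring A] (M : Type v) [AddCommGroup M] [Module A M] : Prop :=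
  ∀ (N N' : Type u) [AddCommGroup N] [Module Aᵐᵒᵖ N] [AddCommGroup N'] [Module Aᵐᵒᵖ N']
    (f : N →ₗ[Aᵐᵒᵖ] N'), Function.Injective f → Function.Injective (BalancedTensor.map f M)

variable {A : Type u} [Ring A] {B : Type v} [Ring B]

/-- `φ` is an epimorphism in the category of rings. -/
def IsRingEpi (φ : A →+* B) : Prop :=
  ∀ (C : Type v) [Ring C] (α β : B →+* C), α.comp φ = β.comp φ → α = β

/-- `φ : A → B` is a perfect right localization (flat epimorphism): it is an epimorphism of rings,
and `B` is flat as a left `A`-module. -/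
def IsPerfectRightLocalization (φ : A →+* B) : Prop :=
  IsRingEpi φ ∧ @IsFlatLeftModule A _ B _ (Module.compHom B φ)

/-- A flat bimorphism: a flat epimorphism that is also injective. -/
def IsFlatBimorphism (φ : A →+* B) : Prop :=
  Function.Injective φ ∧ IsPerfectRightLocalization φ

/-- `S` is the subring `Q_tot(A)` of `Q_max(A)`: the largest among the subrings which contain the
image of `A` and are such that the canonical map of `A` to them is a flat bimorphism. -/
def IsQtot (A : Type u) [Ring A] (S : Subring (Qmax A)) : Prop :=
  IsGreatest {T : Subring (Qmax A) |
    ∃ h : ∀ a : A, toQmax A a ∈ T, IsFlatBimorphism ((toQmax A).codRestrict T h)} S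

end Flat

/-! ### Projective modules, module type and the Grothendieck group -/

section Modules

/-- Every projective left `R`-module is free. -/
def ProjectivesAreFree (R : Type u) [Ring R] : Prop :=
  ∀ (P : Type w) [AddCommGroup P] [Module R P], Module.Projective R P → Module.Free R P

/-- `R` has module type `(m, n)`: `1 ≤ m < n`, and `m` and `n` are the smallest ranks for which
free modules of different ranks are isomorphic. -/
def HasModuleType (R : Type u) [Ring R] (m n : ℕ) : Prop :=
  1 ≤ m ∧ m < n ∧ Nonempty ((Fin m → R) ≃ₗ[R] (Fin n → R)) ∧
    ∀ h k : ℕ, 1 ≤ h → h < k → Nonempty ((Fin h → R) ≃ₗ[R] (Fin k → R)) → m ≤ h ∧ n ≤ k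

/-- A finitely generated projective left `R`-module. -/
structure FGProj (R : Type u) [Ring R] where
  carrier : Type u
  [addCommGroup : AddCommGroup carrier]
  [module : Module R carrier]
  [finite : Module.Finite R carrier]
  [projective : Module.Projective R carrier]

attribute [instance] FGProj.addCommGroup FGProj.module FGProj.finite FGProj.projective

/-- The Grothendieck group `K₀` of finitely generated projective left `R`-modules: generators `[P]`
and relations `[P] = [P₁] + [P₂]` whenever `P ≅ P₁ ⊕ P₂`. -/
abbrev K0 (R : Type u) [Ring R] : Type (u + 1) :=
  FreeAbelianGroup (FGProj R) ⧸ AddSubgroup.closure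
    {z | ∃ P P₁ P₂ : FGProj R, Nonempty (P.carrier ≃ₗ[R] P₁.carrier × P₂.carrier) ∧
      z = FreeAbelianGroup.of P - (FreeAbelianGroup.of P₁ + FreeAbelianGroup.of P₂)}

end Modules

end RightLoc

open RightLoc

/-! The engine is Marshall Hall's theorem for the free algebra `A` (`exists_basis_extension`): a
finitely generated right ideal `M` is free, and a basis of it extends to a basis `x` of a right
ideal `J` of finite codimension. The reason is combinatorial. Elements whose leading words form a
prefix code are right independent, and a finite prefix code can be completed to one that meets every
sufficiently long word.

The coordinate functions of `J` with respect to `x` are partial homomorphisms, hence elements `yᵢ`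
of `Q` with `yᵢ xⱼ = δᵢⱼ` and `∑ xᵢ yᵢ = 1` (`exists_dual_basis`). Thus `J Q = Q` for every `J` in
the topology, and this makes `A → Q` a flat epimorphism. Applied to the right ideal `q I`, where `I`
is the ideal of denominators of `q`, it gives `q Q = e Q` with `e = ∑ xᵢ yᵢ` a partial sum
(`exists_factorization`). Hence `Q` is von Neumann regular and simple, and its principal one-sided
ideals are free. Kaplansky's reduction to countably generated modules then makes all projectives
free.

Conversely, let `A → B` be a flat bimorphism. The numerator ideal `D` of any `b` satisfies `D B =
B`. If a finitely generated `M` with `M B = B` needed an extra basis element `x_d` in Hall's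
theorem, then `x_d ∈ M B` would contradict the independence of `x` over `B`, which flatness
preserves. So `D` has finite codimension, `b` acts as an element of `Q`, and the universal property
and the description of `Q_tot` follow.

For ranks, an invertible `k × h` matrix over `Q` has a graph `G` of finite codimension in both `Aʰ`
and `Aᵏ`. A Schreier formula gives `d + dim (G / ∑ G aᵢ) = h + n d`, where `d` is the codimension in
`Aʰ`, and likewise for `k`; so `h ≡ k` modulo `n - 1`. The generators are a basis of the
augmentation ideal, so `Q ≅ Qⁿ`, and no further isomorphisms of free modules exist. As projectives
are free, rank modulo `n - 1` identifies `K₀`. -/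

namespace RightLoc

/-! ### Rings of right quotients for a faithful Gabriel topology -/

section Generic

variable {A : Type u} [Ring A]

/-- No nonzero element of `A` is annihilated by a member of `F`. -/
def IsFaithfulFilter (F : IdealFilter Aᵐᵒᵖ) : Prop :=
  ∀ J ∈ F, ∀ a : A, (∀ x : A, op x ∈ J → a * x = 0) → a = 0

/-- The right ideal of the `x` in `A` with `b * ψ x ∈ ψ A`. -/
def numerators {B : Type v} [Ring B] (ψ : A →+* B) (b : B) : Ideal Aᵐᵒᵖ where
  carrier := {s | ∃ a : A, b * ψ s.unop = ψ a}
  add_mem' := by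
    rintro s t ⟨a, ha⟩ ⟨a', ha'⟩
    exact ⟨a + a', by rw [unop_add, map_add, map_add, mul_add, ha, ha']⟩
  zero_mem' := ⟨0, by simp⟩
  smul_mem' := by
    rintro c s ⟨a, ha⟩
    exact ⟨a * c.unop, by rw [smul_eq_mul, unop_mul, map_mul, map_mul, ← mul_assoc, ha]⟩

theorem mem_numerators {B : Type v} [Ring B] {ψ : A →+* B} {b : B} {x : A} :
    op x ∈ numerators ψ b ↔ ∃ a : A, b * ψ x = ψ a := Iff.rfl

namespace RightQuotients

variable {F : IdealFilter Aᵐᵒᵖ} [F.IsGabriel]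

/-- The class of a partial homomorphism. -/
def mk (f : PartialHom F) : RightQuotients F := Quotient.mk _ f

theorem mk_mul_ofRing (f : PartialHom F) {x : A} (hx : op x ∈ f.dom) :
    mk f * ofRing F x = ofRing F (f.toFun x) :=
  Quotient.sound ⟨⊤, Order.PFilter.top_mem, fun z _ => f.map_mul x z hx⟩

theorem numerators_mem (q : RightQuotients F) : numerators (ofRing F) q ∈ F := by
  obtain ⟨f, rfl⟩ : ∃ f, mk f = q := Quotient.exists_rep q
  refine Order.PFilter.mem_of_le ?_ f.dom_mem
  intro s hs
  exact ⟨_, mk_mul_ofRing f (x := s.unop) hs⟩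

theorem ofRing_injective (hF : IsFaithfulFilter F) : Function.Injective (ofRing F) := by
  rw [injective_iff_map_eq_zero]
  intro a ha
  obtain ⟨J, hJ, h⟩ := Quotient.exact ha
  exact hF J hJ a fun x hx => (h x hx).trans (zero_mul x)

/-- On `I ⊓ f.dom` the product `q x` is the image of `f x`, so injectivity of `A → Q` makes `f`
vanish on a member of `F`. All later identities in the localization are checked by this
cancellation. -/
theorem eq_zero_of_mul (hF : IsFaithfulFilter F) {I : Ideal Aᵐᵒᵖ} (hI : I ∈ F)
    {q : RightQuotients F} (h : ∀ x : A, op x ∈ I → q * ofRing F x = 0) : q = 0 := by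
  obtain ⟨f, rfl⟩ : ∃ f, mk f = q := Quotient.exists_rep q
  refine Quotient.sound ⟨I ⊓ f.dom, Order.PFilter.inf_mem hI f.dom_mem, fun x hx => ?_⟩
  have h1 := h x hx.1
  rw [mk_mul_ofRing f hx.2] at h1
  have h2 := ofRing_injective hF (h1.trans (map_zero _).symm)
  exact h2.trans (zero_mul x).symm

theorem eq_of_mul (hF : IsFaithfulFilter F) {I : Ideal Aᵐᵒᵖ} (hI : I ∈ F)
    {q q' : RightQuotients F} (h : ∀ x : A, op x ∈ I → q * ofRing F x = q' * ofRing F x) :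
    q = q' :=
  sub_eq_zero.mp (eq_zero_of_mul hF hI fun x hx => by rw [sub_mul, h x hx, sub_self])

theorem exists_of_fun {I : Ideal Aᵐᵒᵖ} (hI : I ∈ F) (f : A → A)
    (hadd : ∀ x y : A, op x ∈ I → op y ∈ I → f (x + y) = f x + f y)
    (hmul : ∀ x r : A, op x ∈ I → f (x * r) = f x * r) :
    ∃ q : RightQuotients F, ∀ x : A, op x ∈ I → q * ofRing F x = ofRing F (f x) :=
  ⟨mk ⟨f, I, hI, hadd, hmul⟩, fun _ hx => mk_mul_ofRing ⟨f, I, hI, hadd, hmul⟩ hx⟩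

variable {B : Type v} [Ring B] {ψ : A →+* B}

/-- A ring of fractions all of whose elements have numerator ideals in `F` maps to the
ring of right quotients. -/
theorem exists_lift (hF : IsFaithfulFilter F) (hψ : Function.Injective ψ)
    (h : ∀ b : B, numerators ψ b ∈ F) : ∃ g : B →+* RightQuotients F, g.comp ψ = ofRing F := by
  have key : ∀ b : B, ∃ q : RightQuotients F, ∀ x a : A, b * ψ x = ψ a →
      q * ofRing F x = ofRing F a := by
    intro b
    choose f hf using fun x : {x : A // op x ∈ numerators ψ b} => mem_numerators.mp x.2
    classical
    -- The value 0 outside the numerator ideal is a dummy. Injectivity of `ψ` makes numerators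
    -- unique, hence additive and right linear in `x`.
    let f' : A → A := fun x => if hx : op x ∈ numerators ψ b then f ⟨x, hx⟩ else 0
    have hf' : ∀ x, op x ∈ numerators ψ b → b * ψ x = ψ (f' x) := by
      intro x hx
      simp only [f', dif_pos hx]
      exact hf ⟨x, hx⟩
    obtain ⟨q, hq⟩ := exists_of_fun (h b) f' (by
      intro x y hx hy
      apply hψ
      rw [← hf' (x + y) (add_mem hx hy), map_add, map_add, mul_add, hf' x hx, hf' y hy]) (by
      intro x r hx
      apply hψ
      rw [← hf' (x * r) (Ideal.mul_mem_left _ (op r) hx), map_mul, map_mul, ← mul_assoc, hf' x hx])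
    refine ⟨q, fun x a hxa => ?_⟩
    rw [hq x ⟨a, hxa⟩]
    exact congrArg _ (hψ ((hf' x ⟨a, hxa⟩).symm.trans hxa))
  choose g hg using key
  refine ⟨{ toFun := g, map_one' := ?_, map_mul' := ?_, map_zero' := ?_, map_add' := ?_ }, ?_⟩
  · refine eq_of_mul hF Order.PFilter.top_mem fun x _ => ?_
    rw [hg 1 x x (one_mul _), one_mul]
  · intro b c
    refine eq_of_mul hF (Order.PFilter.inf_mem (h c) (h (b * c))) fun x ⟨⟨a, ha⟩, a', ha'⟩ => ?_
    rw [hg _ x a' ha', mul_assoc, hg c x a ha, hg b a a']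
    rw [← ha, ← mul_assoc]
    exact ha'
  · refine eq_of_mul hF Order.PFilter.top_mem fun x _ => ?_
    rw [hg 0 x 0 (by simp), map_zero, zero_mul]
  · intro b c
    refine eq_of_mul hF (Order.PFilter.inf_mem (h b) (h c)) fun x ⟨⟨a, ha⟩, a', ha'⟩ => ?_
    rw [add_mul, hg b x a ha, hg c x a' ha', ← map_add]
    refine hg _ x (a + a') ?_
    rw [add_mul, map_add]
    exact congrArg₂ _ ha ha'
  · ext a
    have := hg (ψ a) 1 a (by simp)
    simpa using this

theorem lift_unique (hF : IsFaithfulFilter F) (h : ∀ b : B, numerators ψ b ∈ F)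
    {g g' : B →+* RightQuotients F} (hg : g.comp ψ = ofRing F) (hg' : g'.comp ψ = ofRing F) :
    g = g' := by
  ext b
  refine eq_of_mul hF (h b) fun x ⟨a, ha⟩ => ?_
  have e : ∀ k : B →+* RightQuotients F, k.comp ψ = ofRing F → k b * ofRing F x = ofRing F a := by
    rintro k hk
    rw [← hk, RingHom.comp_apply, RingHom.comp_apply, ← map_mul]
    exact congrArg k ha
  rw [e g hg, e g' hg']

/-- A kernel element would kill all its numerators, and `A` itself embeds. -/
theorem lift_injective (hF : IsFaithfulFilter F)
    (h : ∀ b : B, b ≠ 0 → ∃ x a : A, b * ψ x = ψ a ∧ a ≠ 0)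
    {g : B →+* RightQuotients F} (hg : g.comp ψ = ofRing F) : Function.Injective g := by
  rw [injective_iff_map_eq_zero]
  intro b hb
  by_contra hb0
  obtain ⟨x, a, hxa, ha⟩ := h b hb0
  apply ha
  apply ofRing_injective hF
  rw [map_zero, ← hg, RingHom.comp_apply, ← hxa, map_mul, hb, zero_mul]

end RightQuotients

/-! ### Balanced tensor products -/

namespace BalancedTensor

variable {N : Type w} [AddCommGroup N] [Module Aᵐᵒᵖ N] {M : Type v} [AddCommGroup M] [Module A M]

/-- The pure tensor `n ⊗ m`. -/
def tmul (n : N) (m : M) : BalancedTensor A N M := QuotientAddGroup.mk (n ⊗ₜ[ℤ] m)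

theorem add_tmul (n n' : N) (m : M) :
    tmul (A := A) (n + n') m = tmul n m + tmul n' m := by
  simp only [tmul, TensorProduct.add_tmul, QuotientAddGroup.mk_add]

theorem tmul_add (n : N) (m m' : M) :
    tmul (A := A) n (m + m') = tmul n m + tmul n m' := by
  simp only [tmul, TensorProduct.tmul_add, QuotientAddGroup.mk_add]

theorem zero_tmul (m : M) : tmul (A := A) (0 : N) m = 0 := by
  simp [tmul]

theorem tmul_zero (n : N) : tmul (A := A) n (0 : M) = 0 := by
  simp [tmul]

theorem sum_tmul {ι : Type*} (s : Finset ι) (n : ι → N) (m : M) :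
    tmul (A := A) (∑ i ∈ s, n i) m = ∑ i ∈ s, tmul (n i) m := by
  classical
  induction s using Finset.induction_on with
  | empty => simp [zero_tmul]
  | insert i s hi ih => rw [Finset.sum_insert hi, Finset.sum_insert hi, add_tmul, ih]

theorem tmul_sum {ι : Type*} (s : Finset ι) (n : N) (m : ι → M) :
    tmul (A := A) n (∑ i ∈ s, m i) = ∑ i ∈ s, tmul n (m i) := by
  classical
  induction s using Finset.induction_on with
  | empty => simp [tmul_zero]
  | insert i s hi ih => rw [Finset.sum_insert hi, Finset.sum_insert hi, tmul_add, ih]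

theorem smul_tmul (n : N) (a : A) (m : M) : tmul (A := A) (op a • n) m = tmul n (a • m) := by
  unfold tmul
  rw [← sub_eq_zero, ← QuotientAddGroup.mk_sub, QuotientAddGroup.eq_zero_iff]
  exact AddSubgroup.subset_closure ⟨n, a, m, rfl⟩

theorem exists_sum (z : BalancedTensor A N M) :
    ∃ (ι : Type (max v w)) (s : Finset ι) (n : ι → N) (m : ι → M),
      z = ∑ i ∈ s, tmul (n i) (m i) := by
  obtain ⟨t, rfl⟩ := QuotientAddGroup.mk_surjective z
  obtain ⟨S, hS⟩ := TensorProduct.exists_finset t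
  refine ⟨ULift (N × M), S.map Equiv.ulift.symm.toEmbedding, fun p => p.down.1,
    fun p => p.down.2, ?_⟩
  rw [hS, Finset.sum_map]
  exact map_sum (QuotientAddGroup.mk' (balancedRelations A N M)) _ _

/-- Balanced biadditive maps factor through the balanced tensor product. -/
def lift {P : Type*} [AddCommGroup P] (β : N →+ M →+ P)
    (hβ : ∀ (n : N) (a : A) (m : M), β (op a • n) m = β n (a • m)) :
    BalancedTensor A N M →+ P :=
  QuotientAddGroup.lift _
    (TensorProduct.liftAddHom (R := ℤ) β (fun r n m => by simp)) <| by
    refine (AddSubgroup.closure_le _).mpr ?_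
    rintro _ ⟨n, a, m, rfl⟩
    show (TensorProduct.liftAddHom (R := ℤ) β _) _ = 0
    rw [map_sub, TensorProduct.liftAddHom_tmul, TensorProduct.liftAddHom_tmul, hβ, sub_self]

@[simp]
theorem lift_tmul {P : Type*} [AddCommGroup P] (β : N →+ M →+ P)
    (hβ : ∀ (n : N) (a : A) (m : M), β (op a • n) m = β n (a • m)) (n : N) (m : M) :
    lift β hβ (tmul n m) = β n m := rfl

@[simp]
theorem map_tmul {N' : Type w} [AddCommGroup N'] [Module Aᵐᵒᵖ N'] (f : N →ₗ[Aᵐᵒᵖ] N') (n : N)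
    (m : M) : BalancedTensor.map f M (tmul n m) = tmul (f n) m := rfl

end BalancedTensor

end Generic

/-! ### Flat epimorphisms from numerator ideals -/

section FlatCriterion

variable {A : Type u} [Ring A] {B : Type v} [Ring B] {ψ : A →+* B}

/-- If `b x = a` in `A`, then `α b` and `β b` agree after multiplication by the common image of `x`.
Such `x` generate the unit right ideal of `B`. -/
theorem isRingEpi_of_numerators {F : IdealFilter Aᵐᵒᵖ} (h : ∀ b : B, numerators ψ b ∈ F)
    (h1 : ∀ J ∈ F, ∃ (m : ℕ) (x : Fin m → A) (c : Fin m → B), (∀ k, op (x k) ∈ J) ∧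
      ∑ k, ψ (x k) * c k = 1) : IsRingEpi ψ := by
  intro C _ α β hαβ
  have e : ∀ a, α (ψ a) = β (ψ a) := fun a => congrArg (fun g : A →+* C => g a) hαβ
  ext b
  obtain ⟨m, x, c, hx, hc⟩ := h1 _ (h b)
  choose a ha using fun k => mem_numerators.mp (hx k)
  have e1 : ∑ k, α (ψ (x k)) * α (c k) = 1 := by
    simpa using congrArg α hc
  calc α b = α (b * ∑ k, ψ (x k) * c k) := by rw [hc, mul_one]
    _ = ∑ k, β b * (α (ψ (x k)) * α (c k)) := by
      rw [Finset.mul_sum, map_sum]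
      refine Finset.sum_congr rfl fun k _ => ?_
      rw [← mul_assoc, ha, map_mul, e, ← ha, map_mul, mul_assoc, e]
    _ = β b := by rw [← Finset.mul_sum, e1, mul_one]

/-- With `1 = ∑ xₖ cₖ` and every `bᵢ xₖ` in `A`, one has `∑ nᵢ ⊗ bᵢ = ∑ₖ (∑ᵢ nᵢ (bᵢ xₖ)) ⊗ cₖ`. So
it suffices that the inner sums vanish. This can be tested in `N'`, through the map sending `n ⊗ b`
to the germ along `F` of `x ↦ n (b x)`. -/
theorem isFlatLeftModule_of_numerators [Module A B] (hsmul : ∀ (a : A) (b : B), a • b = ψ a * b)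
    (hψ : Function.Injective ψ)
    {F : IdealFilter Aᵐᵒᵖ} (h : ∀ b : B, numerators ψ b ∈ F)
    (h1 : ∀ J ∈ F, ∃ (m : ℕ) (x : Fin m → A) (c : Fin m → B), (∀ k, op (x k) ∈ J) ∧
      ∑ k, ψ (x k) * c k = 1) : IsFlatLeftModule A B := by
  classical
  intro N N' _ _ _ _ f hf
  rw [injective_iff_map_eq_zero]
  intro z hz
  obtain ⟨ι, s, n, b, rfl⟩ := BalancedTensor.exists_sum z
  -- numerators
  let num : B → A → A := fun b x => if hx : ∃ a : A, b * ψ x = ψ a then hx.choose else 0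
  have hnum : ∀ b x, op x ∈ numerators ψ b → b * ψ x = ψ (num b x) := by
    intro b x hx
    have hx' : ∃ a : A, b * ψ x = ψ a := hx
    simp only [num, dif_pos hx']
    exact hx'.choose_spec
  -- germs of functions along `F`
  let Z : AddSubgroup (A → N') :=
    { carrier := {g | ∃ J ∈ F, ∀ x : A, op x ∈ J → g x = 0}
      zero_mem' := ⟨⊤, Order.PFilter.top_mem, fun _ _ => rfl⟩
      add_mem' := by
        rintro g g' ⟨J, hJ, hg⟩ ⟨J', hJ', hg'⟩
        exact ⟨J ⊓ J', Order.PFilter.inf_mem hJ hJ', fun x hx => by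
          rw [Pi.add_apply, hg x hx.1, hg' x hx.2, add_zero]⟩
      neg_mem' := by
        rintro g ⟨J, hJ, hg⟩
        exact ⟨J, hJ, fun x hx => by rw [Pi.neg_apply, hg x hx, neg_zero]⟩ }
  have hZ : ∀ g g' : A → N', (∃ J ∈ F, ∀ x : A, op x ∈ J → g x = g' x) →
      (QuotientAddGroup.mk g : (A → N') ⧸ Z) = QuotientAddGroup.mk g' := by
    rintro g g' ⟨J, hJ, hg⟩
    rw [← sub_eq_zero, ← QuotientAddGroup.mk_sub, QuotientAddGroup.eq_zero_iff]
    exact ⟨J, hJ, fun x hx => by rw [Pi.sub_apply, hg x hx, sub_self]⟩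
  -- `num` is a choice that is additive and `A`-linear in `b` only on common numerator ideals;
  -- passing to germs repairs this.
  let β : N' →+ B →+ (A → N') ⧸ Z :=
    AddMonoidHom.mk' (fun n => AddMonoidHom.mk'
      (fun b => QuotientAddGroup.mk fun x => op (num b x) • n) (by
        intro b c
        rw [← QuotientAddGroup.mk_add]
        refine hZ _ _ ⟨numerators ψ b ⊓ numerators ψ c ⊓ numerators ψ (b + c),
          Order.PFilter.inf_mem (Order.PFilter.inf_mem (h b) (h c)) (h _), fun x hx => ?_⟩
        have : num (b + c) x = num b x + num c x := by
          apply hψ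
          rw [map_add, ← hnum _ _ hx.2, ← hnum _ _ hx.1.1, ← hnum _ _ hx.1.2, add_mul]
        rw [this, op_add, add_smul, Pi.add_apply])) (by
      intro n n'
      ext b
      simp only [AddMonoidHom.mk'_apply, AddMonoidHom.add_apply]
      rw [← QuotientAddGroup.mk_add]
      exact congrArg _ (funext fun x => smul_add _ _ _))
  have hβ : ∀ (n : N') (a : A) (b : B), β (op a • n) b = β n (a • b) := by
    intro n a b
    refine hZ _ _ ⟨numerators ψ b ⊓ numerators ψ (a • b), Order.PFilter.inf_mem (h _) (h _),
      fun x hx => ?_⟩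
    have : num (a • b) x = a * num b x := by
      apply hψ
      rw [map_mul, ← hnum _ _ hx.2, ← hnum _ _ hx.1, hsmul, mul_assoc]
    rw [this, op_mul, mul_smul]
  have h0 := congrArg (BalancedTensor.lift β hβ) hz
  rw [map_sum, map_sum, map_zero] at h0
  simp only [BalancedTensor.map_tmul, BalancedTensor.lift_tmul] at h0
  have h0' : (QuotientAddGroup.mk (∑ i ∈ s, fun x => op (num (b i) x) • f (n i)) :
      (A → N') ⧸ Z) = 0 := by
    rw [← h0]
    exact map_sum (QuotientAddGroup.mk' Z) _ _
  obtain ⟨J, hJ, hJ0⟩ := (QuotientAddGroup.eq_zero_iff _).mp h0'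
  have hI : s.inf (fun i => numerators ψ (b i)) ∈ F := by
    clear h0 h0' hJ0 hz
    induction s using Finset.induction_on with
    | empty => exact Order.PFilter.top_mem
    | insert i s hi ih => rw [Finset.inf_insert]; exact Order.PFilter.inf_mem (h _) ih
  -- The `xₖ` are taken where the germ vanishes and also where every `bᵢ` has a numerator.
  obtain ⟨m, x, c, hx, hc⟩ := h1 _ (Order.PFilter.inf_mem hJ hI)
  have hx0 : ∀ k, ∑ i ∈ s, op (num (b i) (x k)) • n i = 0 := by
    intro k
    apply hf
    have := hJ0 (x k) (hx k).1
    rw [Finset.sum_apply] at this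
    rw [map_sum, map_zero, ← this]
    exact Finset.sum_congr rfl fun i _ => f.map_smul _ _
  have hxi : ∀ k, ∀ i ∈ s, b i * ψ (x k) = ψ (num (b i) (x k)) := fun k i hi =>
    hnum _ _ (Finset.inf_le (f := fun i => numerators ψ (b i)) hi (hx k).2)
  calc ∑ i ∈ s, BalancedTensor.tmul (A := A) (n i) (b i)
      = ∑ i ∈ s, ∑ k, BalancedTensor.tmul (op (num (b i) (x k)) • n i) (c k) := by
        refine Finset.sum_congr rfl fun i hi => ?_
        have hb : b i = ∑ k, b i * (ψ (x k) * c k) := by rw [← Finset.mul_sum, hc, mul_one]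
        conv_lhs => rw [hb, BalancedTensor.tmul_sum]
        refine Finset.sum_congr rfl fun k _ => ?_
        rw [BalancedTensor.smul_tmul, hsmul, ← hxi k i hi, mul_assoc]
    _ = ∑ k, BalancedTensor.tmul (∑ i ∈ s, op (num (b i) (x k)) • n i) (c k) := by
        rw [Finset.sum_comm]
        exact Finset.sum_congr rfl fun k _ => (BalancedTensor.sum_tmul _ _ _).symm
    _ = 0 := by simp only [hx0, BalancedTensor.zero_tmul, Finset.sum_const_zero]

theorem isFlatBimorphism_of_numerators (hψ : Function.Injective ψ)
    {F : IdealFilter Aᵐᵒᵖ} (h : ∀ b : B, numerators ψ b ∈ F)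
    (h1 : ∀ J ∈ F, ∃ (m : ℕ) (x : Fin m → A) (c : Fin m → B), (∀ k, op (x k) ∈ J) ∧
      ∑ k, ψ (x k) * c k = 1) : IsFlatBimorphism ψ :=
  ⟨hψ, isRingEpi_of_numerators h h1,
    @isFlatLeftModule_of_numerators A _ B _ ψ (Module.compHom B ψ) (fun _ _ => rfl) hψ F h h1⟩

end FlatCriterion

/-! ### Numerators in flat epimorphisms -/

section FlatEpi

variable {A : Type u} [Ring A] {B : Type v} [Ring B] {ψ : A →+* B}

/-- A square zero element commuting with the image of an epimorphism commutes with everything. -/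
theorem IsRingEpi.commute (hψ : IsRingEpi ψ) {C : Type v} [Ring C] (T : B →+* C) {ν : C}
    (hν : ν * ν = 0) (h : ∀ a, ν * T (ψ a) = T (ψ a) * ν) (b : B) : ν * T b = T b * ν := by
  have e1 : (1 - ν) * (1 + ν) = 1 := by
    rw [sub_mul, mul_add, mul_add, hν]; simp
  have e2 : (1 + ν) * (1 - ν) = 1 := by
    rw [add_mul, mul_sub, mul_sub, hν]; simp
  -- Conjugation of `T` by `1 + ν`, whose inverse is `1 - ν`. It agrees with `T` on the image of
  -- `A`, hence everywhere.
  let T' : B →+* C :=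
    { toFun := fun b => (1 + ν) * T b * (1 - ν)
      map_one' := by rw [map_one, mul_one, e2]
      map_mul' := fun x y => by
        rw [map_mul]
        calc (1 + ν) * (T x * T y) * (1 - ν) = (1 + ν) * T x * 1 * T y * (1 - ν) := by
              simp only [mul_assoc, one_mul]
          _ = (1 + ν) * T x * ((1 - ν) * (1 + ν)) * T y * (1 - ν) := by rw [e1]
          _ = _ := by simp only [mul_assoc]
      map_zero' := by simp
      map_add' := fun x y => by rw [map_add, mul_add, add_mul] }
  have hT : T = T' := hψ C T T' <| by
    ext a
    change T (ψ a) = (1 + ν) * T (ψ a) * (1 - ν)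
    rw [add_mul, h, one_mul, ← mul_one_add, mul_assoc, e2, mul_one]
  have hb : T b = (1 + ν) * T b * (1 - ν) := congrArg (fun g : B →+* C => g b) hT
  have : T b * (1 + ν) = (1 + ν) * T b := by
    conv_lhs => rw [hb]
    rw [mul_assoc, e1, mul_one]
  rw [mul_add, add_mul, mul_one, one_mul, add_right_inj] at this
  exact this.symm

/-- Additive maps of right `B`-modules which are linear over `A` are linear over `B` if `A → B` is
an epimorphism. -/
theorem IsRingEpi.map_op_smul (hψ : IsRingEpi ψ) {X Y : Type v} [AddCommGroup X] [AddCommGroup Y]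
    [Module Bᵐᵒᵖ X] [Module Bᵐᵒᵖ Y] (N : X →+ Y)
    (h : ∀ a x, N (op (ψ a) • x) = op (ψ a) • N x) (b : B) (x : X) :
    N (op b • x) = op b • N x := by
  -- `B` acts on the right of `X × Y`, and `ν (x, y) = (0, N x)` has square zero. Commuting with the
  -- action is exactly linearity of `N`.
  let T : B →+* (AddMonoid.End (X × Y))ᵐᵒᵖ :=
    (RingHom.op (Module.toAddMonoidEnd Bᵐᵒᵖ (X × Y))).comp
      (RingEquiv.opOp B).toRingHom
  let ν : AddMonoid.End (X × Y) := (AddMonoidHom.inr X Y).comp (N.comp (AddMonoidHom.fst X Y))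
  have hT : ∀ b p, (T b).unop p = op b • p := fun b p => rfl
  have := hψ.commute T (ν := op ν) (by
    rw [← op_mul]
    refine congrArg op (AddMonoidHom.ext fun p => ?_)
    show ((0 : X), N 0) = 0
    rw [map_zero]; rfl) (by
    intro a
    apply unop_injective
    refine AddMonoidHom.ext fun p => ?_
    show op (ψ a) • ((0 : X), N p.1) = ((0 : X), N (op (ψ a) • p.1))
    rw [h]; ext <;> simp) b
  have := congrArg (fun g => (g.unop (x, 0)).2) this
  exact this.symm

/-- For an epimorphism of rings, the relation `b ⊗ 1 = 1 ⊗ b` in `B ⊗_A B`, expressed by finitely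
many relations. -/
theorem IsRingEpi.exists_relations (hψ : IsRingEpi ψ) (b : B) :
    ∃ (l : ℕ) (ρ : Fin l → (B →₀ A)) (c : Fin l → B),
      (∀ k, (ρ k).sum (fun y a => y * ψ a) = 0) ∧
      ∀ y, ∑ k, ψ (ρ k y) * c k = Finsupp.single b 1 y - Finsupp.single 1 b y := by
  classical
  -- `(B →₀ B) ⧸ S` is a presentation of `B ⊗_A B`, with `single y b` standing for `y ⊗ b`. The map
  -- `N y = y ⊗ 1` is right `A`-linear, hence `B`-linear, and `N (1 · b) = N 1 · b` reads `b ⊗ 1 = 1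
  -- ⊗ b`.
  let R : Set (B →₀ B) := {g | ∃ r : B →₀ A, r.sum (fun y a => y * ψ a) = 0 ∧
    g = r.mapRange ψ (map_zero ψ)}
  let S := Submodule.span Bᵐᵒᵖ R
  have hsum : ∀ r s : B →₀ A, (r + s).sum (fun y a => y * ψ a) =
      r.sum (fun y a => y * ψ a) + s.sum (fun y a => y * ψ a) := fun r s =>
    Finsupp.sum_add_index' (by simp) (by simp [mul_add])
  have hsub : ∀ r s : B →₀ A, (r - s).sum (fun y a => y * ψ a) =
      r.sum (fun y a => y * ψ a) - s.sum (fun y a => y * ψ a) := fun r s =>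
    Finsupp.sum_sub_index (by simp [mul_sub])
  have hsin : ∀ (y : B) (a : A), (Finsupp.single y a).sum (fun y a => y * ψ a) = y * ψ a :=
    fun y a => Finsupp.sum_single_index (by simp)
  let N : B →+ (B →₀ B) ⧸ S := AddMonoidHom.mk' (fun y => S.mkQ (Finsupp.single y 1)) (by
    intro y y'
    rw [← map_add, ← sub_eq_zero, ← map_sub]
    refine (Submodule.Quotient.mk_eq_zero S).mpr (Submodule.subset_span ?_)
    refine ⟨Finsupp.single (y + y') 1 - (Finsupp.single y 1 + Finsupp.single y' 1), ?_, ?_⟩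
    · rw [hsub, hsum, hsin, hsin, hsin]; simp
    · ext z
      simp [Finsupp.single_apply])
  have hN : ∀ y, N y = S.mkQ (Finsupp.single y 1) := fun y => rfl
  have key := hψ.map_op_smul N (by
    intro a y
    rw [hN, hN, ← map_smul, ← sub_eq_zero, ← map_sub]
    refine (Submodule.Quotient.mk_eq_zero S).mpr (Submodule.subset_span ?_)
    refine ⟨Finsupp.single (y * ψ a) 1 - Finsupp.single y a, ?_, ?_⟩
    · rw [hsub, hsin, hsin]; simp
    · ext z
      simp [Finsupp.single_apply]
      split_ifs <;> simp) b 1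
  rw [hN, hN, ← map_smul, ← sub_eq_zero, ← map_sub] at key
  obtain ⟨l, c, g, hg⟩ :=
    (Submodule.mem_span_set').mp ((Submodule.Quotient.mk_eq_zero S).mp key)
  choose ρ hρ hρ' using fun k => (g k).2
  refine ⟨l, ρ, fun k => (c k).unop, hρ, fun y => ?_⟩
  have := congrArg (fun f : B →₀ B => f y) hg
  simp only [Finsupp.finsetSum_apply, Finsupp.smul_apply, hρ', Finsupp.mapRange_apply,
    Finsupp.sub_apply] at this
  rw [show ∑ k, ψ (ρ k y) * (c k).unop = ∑ k, c k • ψ (ρ k y) from rfl, this]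
  congr 1
  · simp
  · by_cases h : 1 = y
    · subst h; simp
    · simp [Finsupp.single_eq_of_ne' h]

end FlatEpi

/-! ### Numerator ideals of a flat epimorphism -/

section FlatNumerators

variable {A : Type u} [Ring A] {B : Type v} [Ring B] {ψ : A →+* B}

/-- If `A / D ⊗ B = 0` then `D B = B`. -/
theorem exists_sum_eq_one_of_tmul_eq_zero [Module A B] (hsmul : ∀ (a : A) (b : B), a • b = ψ a * b)
    (D : Ideal Aᵐᵒᵖ)
    (h : BalancedTensor.tmul (A := A) (Submodule.Quotient.mk (p := D) 1) (1 : B) = 0) :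
    ∃ (m : ℕ) (x : Fin m → A) (c : Fin m → B), (∀ k, op (x k) ∈ D) ∧ ∑ k, ψ (x k) * c k = 1 := by
  -- `E` is the right ideal `D B`; the map `β` below induces `A / D ⊗ B → B / D B`.
  let E : Submodule Bᵐᵒᵖ B := Submodule.span Bᵐᵒᵖ {y | ∃ x : A, op x ∈ D ∧ ψ x = y}
  let β₀ : Aᵐᵒᵖ →+ B →+ B ⧸ E := AddMonoidHom.mk' (fun a =>
      E.mkQ.toAddMonoidHom.comp (AddMonoidHom.mulLeft (ψ a.unop))) (by
    intro a a'
    ext b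
    simp [add_mul])
  have hβ₀ : ∀ a b, β₀ a b = E.mkQ (ψ a.unop * b) := fun a b => rfl
  let β : (Aᵐᵒᵖ ⧸ D) →+ B →+ B ⧸ E := QuotientAddGroup.lift D.toAddSubgroup β₀ (by
    intro a ha
    ext b
    rw [hβ₀]
    refine (Submodule.Quotient.mk_eq_zero E).mpr ?_
    exact E.smul_mem (op b) (Submodule.subset_span ⟨a.unop, ha, rfl⟩))
  have hβ : ∀ a b, β (Submodule.Quotient.mk a) b = E.mkQ (ψ a.unop * b) := fun a b => rfl
  have := congrArg (BalancedTensor.lift (A := A) β (by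
    intro t a b
    obtain ⟨t, rfl⟩ := Submodule.Quotient.mk_surjective D t
    rw [← Submodule.Quotient.mk_smul, hβ, hβ, hsmul, smul_eq_mul, unop_mul, unop_op,
      map_mul ψ, mul_assoc])) h
  rw [BalancedTensor.lift_tmul, map_zero, hβ, unop_one, map_one, one_mul] at this
  obtain ⟨m, c, g, hg⟩ :=
    (Submodule.mem_span_set').mp ((Submodule.Quotient.mk_eq_zero E).mp this)
  choose x hx hx' using fun k => (g k).2
  refine ⟨m, x, fun k => (c k).unop, hx, ?_⟩
  rw [← hg]
  exact Finset.sum_congr rfl fun k _ => by rw [hx']; rfl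

/-- Write `b ⊗ 1 = 1 ⊗ b` through finitely many `A`-relations among 1 and elements `sᵢ ≠ 1`, one of
which is `b`. Dropping the coefficients of 1 gives vectors `rₖ` spanning `R ≤ A^S`. If `v t ∈ R` for
the unit vector `v` of `b`, then the dropped coefficients exhibit `b t` as an element of `A`; these
`t` form `D`. Now `A / D` embeds in `A^S / R` by `1 ↦ v`, and `v ⊗ 1 = ∑ rₖ ⊗ cₖ = 0` there. By
flatness `1 ⊗ 1 = 0` in `A / D ⊗ B`, that is, `D B = B`. -/
theorem exists_numerators_sum_eq_one [Module A B] (hsmul : ∀ (a : A) (b : B), a • b = ψ a * b)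
    (hψ : IsRingEpi ψ) (hflat : IsFlatLeftModule A B) (b : B) :
    ∃ (m : ℕ) (x : Fin m → A) (c : Fin m → B), (∀ k, op (x k) ∈ numerators ψ b) ∧
      ∑ k, ψ (x k) * c k = 1 := by
  classical
  -- The coordinate of 1 is removed below, so `b` must have a coordinate of its own.
  by_cases hb : b = 1
  · subst hb
    exact ⟨1, fun _ => 1, fun _ => 1, fun k => ⟨1, by simp⟩, by simp⟩
  obtain ⟨l, ρ, c, hρ, hc⟩ := hψ.exists_relations b
  let S : Finset B := (insert b (Finset.univ.biUnion fun k => (ρ k).support)).erase 1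
  let s : Fin S.card → B := fun i => (S.equivFin.symm i : B)
  have hs1 : ∀ i, s i ≠ 1 := fun i => (Finset.mem_erase.mp (S.equivFin.symm i).2).1
  have hbS : b ∈ S := Finset.mem_erase.mpr ⟨hb, Finset.mem_insert_self _ _⟩
  let i₀ : Fin S.card := S.equivFin ⟨b, hbS⟩
  have hi₀ : s i₀ = b := by simp [s, i₀]
  have hsinj : Function.Injective s := Subtype.val_injective.comp S.equivFin.symm.injective
  have hsb : ∀ i, b = s i ↔ i₀ = i := fun i => by
    rw [← hi₀]; exact hsinj.eq_iff
  have hρ1 : ∀ k, ψ (ρ k 1) + ∑ i, s i * ψ (ρ k (s i)) = 0 := by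
    intro k
    rw [← hρ k, Finsupp.sum_of_support_subset _ (s := insert 1 S) _ _ (by simp),
      Finset.sum_insert (Finset.notMem_erase _ _), one_mul]
    · congr 1
      rw [← Finset.sum_coe_sort S]
      exact Fintype.sum_equiv S.equivFin.symm _ _ fun i => rfl
    · intro y hy
      by_cases h1 : y = 1
      · exact Finset.mem_insert.mpr (Or.inl h1)
      · exact Finset.mem_insert_of_mem (Finset.mem_erase.mpr ⟨h1, Finset.mem_insert_of_mem
          (Finset.mem_biUnion.mpr ⟨k, Finset.mem_univ _, hy⟩)⟩)
  let r : Fin l → (Fin S.card → A) := fun k i => ρ k (s i)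
  let R : Submodule Aᵐᵒᵖ (Fin S.card → A) := Submodule.span Aᵐᵒᵖ (Set.range r)
  let v : Fin S.card → A := Pi.single i₀ 1
  let T : Aᵐᵒᵖ →ₗ[Aᵐᵒᵖ] (Fin S.card → A) ⧸ R := LinearMap.toSpanSingleton Aᵐᵒᵖ _ (R.mkQ v)
  let D : Ideal Aᵐᵒᵖ := LinearMap.ker T
  have hD : ∀ t : A, op t ∈ D → op t ∈ numerators ψ b := by
    intro t ht
    have ht' : op t • v ∈ R := by
      have : R.mkQ (op t • v) = 0 := ht
      exact (Submodule.Quotient.mk_eq_zero R).mp this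
    obtain ⟨w, hw⟩ := (Submodule.mem_span_range_iff_exists_fun _).mp ht'
    refine ⟨-∑ k, ρ k 1 * (w k).unop, ?_⟩
    have h1 : ∀ i, ∑ k, ρ k (s i) * (w k).unop = if i₀ = i then t else 0 := by
      intro i
      have := congrArg (fun f => f i) hw
      simp only [Finset.sum_apply, Pi.smul_apply] at this
      rw [show ∑ k, ρ k (s i) * (w k).unop = ∑ k, w k • r k i from rfl, this]
      by_cases h : i₀ = i
      · subst h; simp [v]
      · simp [v, h]
    have h2 : b * ψ t = ∑ i, s i * ψ (∑ k, ρ k (s i) * (w k).unop) := by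
      simp only [h1]
      rw [Finset.sum_eq_single i₀]
      · simp [hi₀]
      · intro i _ hi
        simp [Ne.symm hi]
      · simp
    have h3 : ∀ k, ψ (ρ k 1) = -∑ i, s i * ψ (ρ k (s i)) := fun k =>
      eq_neg_of_add_eq_zero_left (hρ1 k)
    rw [unop_op, h2, map_neg, map_sum]
    simp only [map_sum, map_mul, h3, neg_mul, Finset.sum_neg_distrib, neg_neg, Finset.mul_sum,
      Finset.sum_mul]
    rw [Finset.sum_comm]
    simp only [mul_assoc]
  let f : (Aᵐᵒᵖ ⧸ D) →ₗ[Aᵐᵒᵖ] (Fin S.card → A) ⧸ R := D.liftQ T le_rfl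
  have hf : Function.Injective f := by
    rw [← LinearMap.ker_eq_bot]
    exact Submodule.ker_liftQ_eq_bot _ _ _ le_rfl
  obtain ⟨m, x, d, hx, hd⟩ := exists_sum_eq_one_of_tmul_eq_zero hsmul D <| by
    refine (injective_iff_map_eq_zero _).mp (hflat _ _ f hf) _ ?_
    rw [BalancedTensor.map_tmul]
    have hf1 : f (Submodule.Quotient.mk 1) = R.mkQ v := by
      show T 1 = _
      exact LinearMap.toSpanSingleton_apply_one _ _ _
    rw [hf1]
    let ε : Fin S.card → (Fin S.card → A) ⧸ R := fun i => R.mkQ (Pi.single i 1)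
    have hε : ∀ (g : Fin S.card → A) (y : B), BalancedTensor.tmul (A := A) (R.mkQ g) y =
        ∑ i, BalancedTensor.tmul (ε i) (ψ (g i) * y) := by
      intro g y
      have hg : g = ∑ i, op (g i) • (Pi.single i 1 : Fin S.card → A) := by
        ext j
        simp [Finset.sum_apply, Pi.single_apply]
      conv_lhs => rw [hg, map_sum, BalancedTensor.sum_tmul]
      refine Finset.sum_congr rfl fun i _ => ?_
      rw [map_smul, BalancedTensor.smul_tmul, hsmul]
    have h0 : ∀ k, ∑ i, BalancedTensor.tmul (A := A) (ε i) (ψ (r k i) * c k) = 0 := by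
      intro k
      rw [← hε, show R.mkQ (r k) = 0 from
        (Submodule.Quotient.mk_eq_zero R).mpr (Submodule.subset_span ⟨k, rfl⟩),
        BalancedTensor.zero_tmul]
    calc BalancedTensor.tmul (A := A) (R.mkQ v) (1 : B)
        = ∑ i, BalancedTensor.tmul (ε i) (∑ k, ψ (r k i) * c k) := by
          rw [hε]
          refine Finset.sum_congr rfl fun i _ => ?_
          rw [show ∑ k, ψ (r k i) * c k = _ from hc (s i), Finsupp.single_eq_of_ne (hs1 i),
            sub_zero]
          by_cases h : i₀ = i
          · subst h; simp [v, hi₀]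
          · rw [Finsupp.single_eq_of_ne' (fun e => h ((hsb i).mp e))]
            simp [v, Pi.single_eq_of_ne' h]
      _ = 0 := by
          simp only [BalancedTensor.tmul_sum]
          rw [Finset.sum_comm]
          simp only [h0, Finset.sum_const_zero]
  exact ⟨m, x, d, fun k => hD _ (hx k), hd⟩

end FlatNumerators

/-! ### Leading words in free algebras -/

section Words

variable {n : ℕ}

/-- The number with the letters of a word as its (nonzero) digits in base `n + 2`. Comparing
these numbers orders words first by length, then lexicographically. -/
def wordVal (w : FreeMonoid (Fin n)) : ℕ :=
  Nat.ofDigits (n + 2) (w.toList.reverse.map fun i : Fin n => (i : ℕ) + 1)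

theorem wordVal_mul (w v : FreeMonoid (Fin n)) :
    wordVal (w * v) = wordVal v + (n + 2) ^ v.toList.length * wordVal w := by
  simp [wordVal, FreeMonoid.toList_mul, Nat.ofDigits_append]

/-- The letters give digits from 1 to `n`, so no leading zero is lost and the word can be read off.
Base `n + 2` exceeds 1 even for `n = 0`. -/
theorem digits_wordVal (w : FreeMonoid (Fin n)) :
    Nat.digits (n + 2) (wordVal w) = w.toList.reverse.map fun i : Fin n => (i : ℕ) + 1 := by
  refine Nat.digits_ofDigits _ (by omega) _ ?_ ?_
  · intro l hl
    obtain ⟨⟨i, hi⟩, -, rfl⟩ := List.mem_map.mp hl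
    show i + 1 < n + 2
    omega
  · intro h
    obtain ⟨i, -, hi⟩ := List.mem_map.mp (List.getLast_mem h)
    omega

theorem wordVal_injective : Function.Injective (wordVal (n := n)) := by
  intro w v h
  have := congrArg (Nat.digits (n + 2)) h
  rw [digits_wordVal, digits_wordVal] at this
  have := List.map_injective_iff.mpr
    (fun (i j : Fin n) (hij : (i : ℕ) + 1 = j + 1) => Fin.ext (Nat.succ_injective hij)) this
  exact FreeMonoid.toList.injective (List.reverse_injective this)

theorem length_le_of_wordVal_le {w v : FreeMonoid (Fin n)} (h : wordVal w ≤ wordVal v) :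
    w.toList.length ≤ v.toList.length := by
  have := Nat.le_length_digits_le (n + 2) _ _ h
  simpa [digits_wordVal] using this

/-- A right factor of larger value is at least as long, so the power of the base that shifts the
left factor does not drop. -/
theorem wordVal_mul_le {w w' v v' : FreeMonoid (Fin n)} (h : wordVal w ≤ wordVal w')
    (h' : wordVal v ≤ wordVal v') : wordVal (w * v) ≤ wordVal (w' * v') := by
  rw [wordVal_mul, wordVal_mul]
  have := length_le_of_wordVal_le h'
  gcongr
  omega

/-- Two inequalities whose sum is an equality are equalities. Hence the product of two leading words
arises from only one pair of words in a product of elements. -/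
theorem eq_of_mul_eq_mul_of_wordVal_le {w w' v v' : FreeMonoid (Fin n)}
    (h : wordVal w ≤ wordVal w') (h' : wordVal v ≤ wordVal v') (e : w * v = w' * v') :
    w = w' ∧ v = v' := by
  have e1 := congrArg wordVal e
  rw [wordVal_mul, wordVal_mul] at e1
  have hl := length_le_of_wordVal_le h'
  have h2 : (n + 2) ^ v.toList.length * wordVal w ≤ (n + 2) ^ v'.toList.length * wordVal w' := by
    gcongr
    omega
  have hv : v = v' := wordVal_injective (by omega)
  subst hv
  exact ⟨mul_right_cancel e, rfl⟩

end Words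

section Leading

variable {K : Type u} [Field K] {n : ℕ}

local notation "𝔸" => FreeAlgebra K (Fin n)
local notation "𝕎" => FreeMonoid (Fin n)

/-- The coefficient of a word. -/
noncomputable def wcoeff (f : FreeAlgebra K (Fin n)) : FreeMonoid (Fin n) →₀ K :=
  (FreeAlgebra.equivMonoidAlgebraFreeMonoid f).coeff

/-- The monomial of a word. -/
noncomputable def wmon (K : Type u) [Field K] {n : ℕ} (w : FreeMonoid (Fin n)) :
    FreeAlgebra K (Fin n) :=
  FreeAlgebra.equivMonoidAlgebraFreeMonoid.symm (MonoidAlgebra.single w 1)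

theorem wcoeff_add (f g : 𝔸) : wcoeff (f + g) = wcoeff f + wcoeff g := by
  simp [wcoeff]

theorem wcoeff_sub (f g : 𝔸) : wcoeff (f - g) = wcoeff f - wcoeff g := by
  rw [eq_sub_iff_add_eq, ← wcoeff_add, sub_add_cancel]

theorem wcoeff_smul (c : K) (f : 𝔸) : wcoeff (c • f) = c • wcoeff f := by
  simp [wcoeff]

theorem wcoeff_sum {ι : Type*} (s : Finset ι) (f : ι → 𝔸) (w : 𝕎) :
    wcoeff (∑ i ∈ s, f i) w = ∑ i ∈ s, wcoeff (f i) w := by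
  simp [wcoeff, map_sum]

theorem wcoeff_zero : wcoeff (0 : 𝔸) = 0 := by
  simp [wcoeff]

theorem wcoeff_eq_zero {f : 𝔸} : wcoeff f = 0 ↔ f = 0 := by
  rw [wcoeff, MonoidAlgebra.coeff_eq_zero, map_eq_zero_iff _ (AlgEquiv.injective _)]

theorem wcoeff_wmon (w : 𝕎) : wcoeff (wmon K w) = Finsupp.single w 1 := by
  simp [wcoeff, wmon]

/-- `w` is the largest word of `f`. -/
def IsLead (f : FreeAlgebra K (Fin n)) (w : FreeMonoid (Fin n)) : Prop :=
  wcoeff f w ≠ 0 ∧ ∀ v, wcoeff f v ≠ 0 → wordVal v ≤ wordVal w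

theorem exists_isLead {f : 𝔸} (hf : f ≠ 0) : ∃ w, IsLead f w := by
  have : (wcoeff f).support.Nonempty := by
    rw [Finsupp.support_nonempty_iff]
    exact fun h => hf (wcoeff_eq_zero.mp h)
  obtain ⟨w, hw, h⟩ := Finset.exists_max_image _ wordVal this
  exact ⟨w, Finsupp.mem_support_iff.mp hw, fun v hv => h v (Finsupp.mem_support_iff.mpr hv)⟩

theorem IsLead.ne_zero {f : 𝔸} {w : 𝕎} (h : IsLead f w) : f ≠ 0 := by
  rintro rfl
  exact h.1 (by simp [wcoeff_zero])

theorem isLead_wmon (w : 𝕎) : IsLead (wmon K w) w := by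
  classical
  constructor
  · simp [wcoeff_wmon]
  · intro v hv
    rw [wcoeff_wmon, Finsupp.single_apply] at hv
    by_cases h : w = v
    · rw [h]
    · simp [h] at hv

theorem IsLead.mul {f g : 𝔸} {w v : 𝕎} (hf : IsLead f w) (hg : IsLead g v) :
    IsLead (f * g) (w * v) := by
  classical
  constructor
  · rw [wcoeff, map_mul FreeAlgebra.equivMonoidAlgebraFreeMonoid, MonoidAlgebra.coeff_mul_mul_of_uniqueMul]
    · exact mul_ne_zero hf.1 hg.1
    · intro a b ha hb e
      exact eq_of_mul_eq_mul_of_wordVal_le (hf.2 _ (Finsupp.mem_support_iff.mp ha))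
        (hg.2 _ (Finsupp.mem_support_iff.mp hb)) e
  · intro u hu
    rw [wcoeff, map_mul FreeAlgebra.equivMonoidAlgebraFreeMonoid] at hu
    have := MonoidAlgebra.support_coeff_mul_subset _ _ (Finsupp.mem_support_iff.mpr hu)
    obtain ⟨a, ha, b, hb, rfl⟩ := Finset.mem_mul.mp this
    exact wordVal_mul_le (hf.2 _ (Finsupp.mem_support_iff.mp ha))
      (hg.2 _ (Finsupp.mem_support_iff.mp hb))

/-- Reduction modulo a subspace with enough leading words. -/
theorem le_of_isLead {S T : Submodule K 𝔸}
    (h : ∀ t ∈ T, ∀ w, IsLead t w → ∃ s ∈ S, s ∈ T ∧ IsLead s w) : T ≤ S := by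
  have key : ∀ N : ℕ, ∀ t ∈ T, ∀ w, IsLead t w → wordVal w = N → t ∈ S := by
    intro N
    induction N using Nat.strong_induction_on with
    | _ N ih =>
      rintro t ht w hw rfl
      obtain ⟨s, hs, hsT, hsw⟩ := h t ht w hw
      -- This scalar cancels the leading term, so `t - c • s` is zero or has a smaller leading word.
      -- It stays in `T` because `s ∈ T`.
      set c := wcoeff t w / wcoeff s w
      set t' := t - c • s with ht'
      have ht'T : t' ∈ T := sub_mem ht (T.smul_mem c hsT)
      have : t' ∈ S := by
        by_cases h0 : t' = 0
        · rw [h0]; exact zero_mem _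
        obtain ⟨v, hv⟩ := exists_isLead h0
        refine ih (wordVal v) ?_ t' ht'T v hv rfl
        have hcoeff : ∀ u, wcoeff t' u = wcoeff t u - c * wcoeff s u := fun u => by
          rw [ht', wcoeff_sub, wcoeff_smul]; rfl
        refine lt_of_le_of_ne ?_ ?_
        · by_contra hlt
          apply hv.1
          rw [hcoeff, not_not.mp fun hne => hlt (hw.2 v hne),
            not_not.mp fun hne => hlt (hsw.2 v hne)]
          simp
        · intro e
          apply hv.1
          rw [wordVal_injective e, hcoeff, div_mul_cancel₀ _ hsw.1, sub_self]
      have e : t = t' + c • s := by rw [ht', sub_add_cancel]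
      rw [e]
      exact add_mem this (S.smul_mem c hs)
  intro t ht
  by_cases h0 : t = 0
  · rw [h0]; exact zero_mem _
  obtain ⟨w, hw⟩ := exists_isLead h0
  exact key _ t ht w hw rfl

theorem IsLead.unique {f : 𝔸} {w v : 𝕎} (hw : IsLead f w) (hv : IsLead f v) : w = v :=
  wordVal_injective (le_antisymm (hv.2 _ hw.1) (hw.2 _ hv.1))

/-- Nonzero elements with different leading words do not cancel. -/
theorem eq_zero_of_sum_eq_zero {ι : Type*} {s : Finset ι} {g : ι → 𝔸}
    (hg : ∀ i j w, IsLead (g i) w → IsLead (g j) w → i = j) (h : ∑ i ∈ s, g i = 0) :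
    ∀ i ∈ s, g i = 0 := by
  classical
  by_contra! hne
  obtain ⟨i, hi, hi0⟩ := hne
  choose! l hl using fun (i : ι) (h : g i ≠ 0) => exists_isLead h
  obtain ⟨j, hj, hmax⟩ := Finset.exists_max_image (s.filter fun i => g i ≠ 0)
    (fun i => wordVal (l i)) ⟨i, Finset.mem_filter.mpr ⟨hi, hi0⟩⟩
  obtain ⟨hjs, hj0⟩ := Finset.mem_filter.mp hj
  apply (hl j hj0).1
  -- At the largest leading word only the term `j` has a nonzero coefficient: any other such term
  -- would have the same leading word.
  rw [← Finset.sum_eq_single_of_mem (f := fun i => wcoeff (g i) (l j)) j hjs]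
  · rw [← wcoeff_sum, h, wcoeff_zero]
    rfl
  · intro k hk hkj
    by_contra hne
    have hk0 : g k ≠ 0 := by
      intro h0
      rw [h0, wcoeff_zero] at hne
      exact hne rfl
    have e : l j = l k := wordVal_injective (le_antisymm ((hl k hk0).2 _ hne)
      (hmax k (Finset.mem_filter.mpr ⟨hk, hk0⟩)))
    exact hkj (hg _ _ _ (hl k hk0) (e ▸ hl j hj0))

/-- Elements whose leading words form a prefix code are independent on the right. -/
theorem linearIndependent_of_isLead {ι : Type*} {x : ι → 𝔸} {w : ι → 𝕎}
    (hx : ∀ i, IsLead (x i) (w i)) (hw : ∀ i j a b, w i * a = w j * b → i = j) :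
    LinearIndependent 𝔸ᵐᵒᵖ x := by
  rw [linearIndependent_iff']
  intro s f hf i hi
  have key : ∀ i u, IsLead (x i * (f i).unop) u → ∃ l, u = w i * l := by
    intro i u hu
    obtain ⟨l, hl⟩ := exists_isLead (right_ne_zero_of_mul hu.ne_zero)
    exact ⟨l, hu.unique ((hx i).mul hl)⟩
  have := eq_zero_of_sum_eq_zero (g := fun i => x i * (f i).unop) (fun i j u hi hj => by
    obtain ⟨l, rfl⟩ := key i u hi
    obtain ⟨l', e⟩ := key j _ hj
    exact hw _ _ _ _ e) hf i hi
  exact unop_injective ((mul_eq_zero.mp this).resolve_left (hx i).ne_zero)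

/-- A generator of the free algebra is its own leading word. -/
theorem isLead_ι (i : Fin n) : IsLead (FreeAlgebra.ι K i) (FreeMonoid.of i) := by
  have : FreeAlgebra.ι K i = wmon K (FreeMonoid.of i) := by
    rw [wmon, AlgEquiv.eq_symm_apply]
    simp [FreeAlgebra.equivMonoidAlgebraFreeMonoid]
  rw [this]
  exact isLead_wmon _

/-- The generators are independent on the left. -/
theorem eq_zero_of_sum_mul_ι_eq_zero {f : Fin n → 𝔸} (h : ∑ i, f i * FreeAlgebra.ι K i = 0)
    (i : Fin n) : f i = 0 := by
  have key : ∀ i u, IsLead (f i * FreeAlgebra.ι K i) u → ∃ l, u = l * FreeMonoid.of i := by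
    intro i u hu
    obtain ⟨l, hl⟩ := exists_isLead (left_ne_zero_of_mul hu.ne_zero)
    exact ⟨l, hu.unique (hl.mul (isLead_ι i))⟩
  have := eq_zero_of_sum_eq_zero (g := fun i => f i * FreeAlgebra.ι K i) (fun i j u hi hj => by
    obtain ⟨l, rfl⟩ := key i u hi
    obtain ⟨l', e⟩ := key j _ hj
    have e' : l.toList ++ [i] = l'.toList ++ [j] := congrArg FreeMonoid.toList e
    exact List.singleton_injective (List.append_inj' e' rfl).2) h i (Finset.mem_univ i)
  exact (mul_eq_zero.mp this).resolve_right (isLead_ι i).ne_zero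

/-- Every element is the sum of its constant term and a combination of the generators. -/
theorem exists_eq_add_sum_mul_ι (a : 𝔸) : ∃ f : Fin n → 𝔸,
    a = algebraMap K 𝔸 (FreeAlgebra.algebraMapInv a) + ∑ i, f i * FreeAlgebra.ι K i := by
  classical
  induction a with
  | grade0 r => exact ⟨0, by simp [FreeAlgebra.algebraMapInv]⟩
  | grade1 i => exact ⟨Pi.single i 1, by simp [FreeAlgebra.algebraMapInv, Pi.single_apply]⟩
  | add a b ha hb =>
    obtain ⟨f, hf⟩ := ha
    obtain ⟨g, hg⟩ := hb
    refine ⟨f + g, ?_⟩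
    conv_lhs => rw [hf, hg]
    simp only [map_add, Pi.add_apply, add_mul, Finset.sum_add_distrib]
    abel
  | mul a b ha hb =>
    obtain ⟨f, hf⟩ := ha
    obtain ⟨g, hg⟩ := hb
    -- With `ε` the constant term, `a b = ε(b) a + a ∑ gᵢ aᵢ`, and then the first `a` is expanded.
    refine ⟨fun i => FreeAlgebra.algebraMapInv b • f i + a * g i, ?_⟩
    simp only [add_mul, Finset.sum_add_distrib, mul_assoc, ← Finset.mul_sum, smul_mul_assoc,
      ← Finset.smul_sum]
    have h1 : a * b = FreeAlgebra.algebraMapInv b • a + a * ∑ i, g i * FreeAlgebra.ι K i := by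
      conv_lhs => rw [hg, mul_add, ← Algebra.commutes, ← Algebra.smul_def]
    have h2 : FreeAlgebra.algebraMapInv b • a =
        algebraMap K 𝔸 (FreeAlgebra.algebraMapInv (a * b)) +
          FreeAlgebra.algebraMapInv b • ∑ i, f i * FreeAlgebra.ι K i := by
      conv_lhs => rw [hf, smul_add]
      rw [Algebra.smul_def, ← map_mul, map_mul FreeAlgebra.algebraMapInv a b, mul_comm]
    exact h1.trans (by rw [h2, add_assoc])

end Leading

/-! ### Marshall Hall's theorem -/

section Hall

variable {K : Type u} [Field K] {n : ℕ}

/-- The right ideal as an ideal of the opposite ring. -/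
def toIdealOp {A : Type u} [Ring A] (M : Submodule Aᵐᵒᵖ A) : Ideal Aᵐᵒᵖ where
  carrier := {s | s.unop ∈ M}
  add_mem' hs ht := M.add_mem hs ht
  zero_mem' := M.zero_mem
  smul_mem' c _ hs := M.smul_mem c hs

theorem op_mem_toIdealOp {A : Type u} [Ring A] {M : Submodule Aᵐᵒᵖ A} {a : A} :
    op a ∈ toIdealOp M ↔ a ∈ M := Iff.rfl

/-- The `K`-subspace underlying a right ideal of a free algebra. -/
def rightSubspace (M : Submodule (FreeAlgebra K (Fin n))ᵐᵒᵖ (FreeAlgebra K (Fin n))) :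
    Submodule K (FreeAlgebra K (Fin n)) where
  carrier := M
  add_mem' hs ht := M.add_mem hs ht
  zero_mem' := M.zero_mem
  smul_mem' c x hx := by
    have : c • x = op (algebraMap K (FreeAlgebra K (Fin n)) c) • x := by
      rw [op_smul_eq_mul, Algebra.smul_def, Algebra.commutes]
    rw [this]
    exact M.smul_mem _ hx

theorem toIdealOp_mem_fcFilter {M : Submodule (FreeAlgebra K (Fin n))ᵐᵒᵖ (FreeAlgebra K (Fin n))}
    (V : Submodule K (FreeAlgebra K (Fin n))) (hV : V.FG) (h : ⊤ ≤ rightSubspace M ⊔ V) :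
    toIdealOp M ∈ fcFilter K (FreeAlgebra K (Fin n)) := by
  rw [mem_fcFilter]
  refine Submodule.FG.cofg_of_codisjoint
    (S := V.map (opLinearEquiv K : FreeAlgebra K (Fin n) ≃ₗ[K] _).toLinearMap) ?_ (hV.map _)
  rw [codisjoint_iff, ← top_le_iff]
  intro s _
  obtain ⟨m, hm, y, hy, e⟩ := Submodule.mem_sup.mp (h (Submodule.mem_top (x := s.unop)))
  have hs : s = op y + op m := by rw [← op_add, add_comm y, e, op_unop]
  rw [hs]
  exact add_mem (Submodule.mem_sup_left ⟨y, hy, rfl⟩) (Submodule.mem_sup_right hm)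

/-- Every word in a set of words has a shortest prefix in that set. -/
theorem exists_minimal_prefix {L : Set (FreeMonoid (Fin n))} {w : FreeMonoid (Fin n)}
    (hw : w ∈ L) : ∃ p ∈ L, (∃ a, w = p * a) ∧
      ∀ q ∈ L, ∀ a, p = q * a → q = p := by
  classical
  let P : ℕ → Prop := fun k => ∃ p ∈ L, (∃ a, w = p * a) ∧ p.toList.length = k
  have hP : ∃ k, P k := ⟨_, w, hw, ⟨1, (mul_one w).symm⟩, rfl⟩
  obtain ⟨p, hp, ⟨a, ha⟩, hlen⟩ := Nat.find_spec hP
  refine ⟨p, hp, ⟨a, ha⟩, fun q hq b hb => ?_⟩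
  have h1 : Nat.find hP ≤ q.toList.length :=
    Nat.find_min' hP ⟨q, hq, ⟨b * a, by rw [ha, hb, mul_assoc]⟩, rfl⟩
  have h2 : p.toList.length = q.toList.length + b.toList.length := by
    rw [hb, FreeMonoid.toList_mul, List.length_append]
  have h3 : b.toList.length = 0 := by omega
  have h4 : b = 1 := FreeMonoid.toList.injective (List.length_eq_zero_iff.mp h3)
  rw [hb, h4, mul_one]

theorem eq_mul_or_eq_mul {p q a b : FreeMonoid (Fin n)} (h : p * a = q * b) :
    (∃ c, q = p * c) ∨ ∃ c, p = q * c := by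
  have h' : p.toList ++ a.toList = q.toList ++ b.toList := congrArg FreeMonoid.toList h
  rcases List.append_eq_append_iff.mp h' with ⟨c, hc, -⟩ | ⟨c, hc, -⟩
  · exact Or.inl ⟨FreeMonoid.ofList c, FreeMonoid.toList.injective hc⟩
  · exact Or.inr ⟨FreeMonoid.ofList c, FreeMonoid.toList.injective hc⟩

/-- Marshall Hall's theorem for free algebras: a basis of a finitely generated right ideal extends
to a basis of a right ideal of finite codimension. -/
theorem exists_basis_extension
    (M : Submodule (FreeAlgebra K (Fin n))ᵐᵒᵖ (FreeAlgebra K (Fin n))) (hM : M.FG) :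
    ∃ (C₁ C₂ : Type) (_ : Finite C₁) (_ : Finite C₂) (x : C₁ ⊕ C₂ → FreeAlgebra K (Fin n)),
      LinearIndependent (FreeAlgebra K (Fin n))ᵐᵒᵖ x ∧
      Submodule.span (FreeAlgebra K (Fin n))ᵐᵒᵖ (Set.range (x ∘ Sum.inl)) = M ∧
      toIdealOp (Submodule.span (FreeAlgebra K (Fin n))ᵐᵒᵖ (Set.range x)) ∈
        fcFilter K (FreeAlgebra K (Fin n)) := by
  classical
  -- `L` is the set of leading words of `M`, and `P` its members with no proper prefix in `L`. They
  -- form a prefix code, and elements of `M` with these leading words form a basis of `M`.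
  let L : Set (FreeMonoid (Fin n)) := {w | ∃ f ∈ M, IsLead f w}
  let P : Set (FreeMonoid (Fin n)) := {p | p ∈ L ∧ ∀ q ∈ L, ∀ a, p = q * a → q = p}
  have hPcode : ∀ p ∈ P, ∀ q ∈ P, ∀ a b, p * a = q * b → p = q := by
    intro p hp q hq a b h
    rcases eq_mul_or_eq_mul h with ⟨c, hc⟩ | ⟨c, hc⟩
    · exact hq.2 p hp.1 c hc
    · exact (hp.2 q hq.1 c hc).symm
  choose y hyM hy using fun p : P => p.2.1
  have hyli : LinearIndependent (FreeAlgebra K (Fin n))ᵐᵒᵖ y :=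
    linearIndependent_of_isLead hy fun p q a b h => Subtype.ext (hPcode p p.2 q q.2 a b h)
  have hspan : Submodule.span (FreeAlgebra K (Fin n))ᵐᵒᵖ (Set.range y) = M := by
    refine le_antisymm (Submodule.span_le.mpr (Set.range_subset_iff.mpr hyM)) ?_
    suffices h : rightSubspace M ≤ rightSubspace (Submodule.span _ (Set.range y)) from
      fun t ht => h ht
    refine le_of_isLead ?_
    intro t ht w hw
    obtain ⟨p, hp, ⟨a, ha⟩, hmin⟩ := exists_minimal_prefix (L := L) ⟨t, ht, hw⟩
    refine ⟨y ⟨p, hp, hmin⟩ * wmon K a, ?_, ?_, ?_⟩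
    · exact Submodule.smul_mem _ (op (wmon K a)) (Submodule.subset_span ⟨_, rfl⟩)
    · exact M.smul_mem (op (wmon K a)) (hyM _)
    · rw [ha]
      exact (hy _).mul (isLead_wmon a)
  have hPfin : Finite P := by
    have : Module.Finite (FreeAlgebra K (Fin n))ᵐᵒᵖ
        (Submodule.span (FreeAlgebra K (Fin n))ᵐᵒᵖ (Set.range y)) :=
      Module.Finite.iff_fg.mpr (hspan ▸ hM)
    exact Module.Finite.finite_basis (Module.Basis.span hyli)
  obtain ⟨D, hD⟩ : ∃ D : ℕ, ∀ p ∈ P, p.toList.length ≤ D := by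
    obtain ⟨D, hD⟩ := (Set.toFinite ((fun p : FreeMonoid (Fin n) => p.toList.length) '' P)).bddAbove
    exact ⟨D, fun p hp => hD ⟨p, hp, rfl⟩⟩
  -- The words of length `D` with no prefix in `P` complete the code: every word of length at least
  -- `D` begins with exactly one member of `P ∪ P'`. Modulo the new right ideal, only the words
  -- shorter than `D` are needed.
  let P' : Set (FreeMonoid (Fin n)) :=
    {w | w.toList.length = D ∧ ∀ p ∈ P, ∀ a, w ≠ p * a}
  have hlenfin : ∀ k, {w : FreeMonoid (Fin n) | w.toList.length = k}.Finite := fun k =>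
    List.finite_length_eq (Fin n) k
  have hP'fin : Finite P' := (hlenfin D).subset fun w hw => hw.1
  let x : P ⊕ P' → FreeAlgebra K (Fin n) := Sum.elim y fun w => wmon K w.1
  let c : P ⊕ P' → FreeMonoid (Fin n) := Sum.elim Subtype.val Subtype.val
  have hx : ∀ i, IsLead (x i) (c i) := by
    rintro (p | w)
    · exact hy p
    · exact isLead_wmon _
  have hPP' : ∀ p ∈ P, ∀ w ∈ P', ∀ a b, p * a ≠ w * b := by
    intro p hp w hw a b h
    rcases eq_mul_or_eq_mul h with ⟨d, hd⟩ | ⟨d, hd⟩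
    · exact hw.2 p hp d hd
    · have h1 := hD p hp
      have h2 := hw.1
      rw [hd, FreeMonoid.toList_mul, List.length_append] at h1
      have h4 : d = 1 := FreeMonoid.toList.injective (List.length_eq_zero_iff.mp (by omega))
      exact hw.2 p hp 1 (by rw [hd, h4, mul_one, mul_one])
  have hcode : ∀ i j a b, c i * a = c j * b → i = j := by
    rintro (p | w) (q | z) a b h
    · exact congrArg _ (Subtype.ext (hPcode p p.2 q q.2 a b h))
    · exact (hPP' p p.2 z z.2 a b h).elim
    · exact (hPP' q q.2 w w.2 b a h.symm).elim
    · refine congrArg _ (Subtype.ext (FreeMonoid.toList.injective ?_))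
      exact (List.append_inj (congrArg FreeMonoid.toList h : w.1.toList ++ a.toList =
        z.1.toList ++ b.toList) (w.2.1.trans z.2.1.symm)).1
  refine ⟨P, P', hPfin, hP'fin, x, linearIndependent_of_isLead hx hcode, hspan, ?_⟩
  have hVfin : ((wmon K) '' {w : FreeMonoid (Fin n) | w.toList.length < D}).Finite := by
    refine Set.Finite.image _ ?_
    refine (Set.Finite.biUnion (Set.finite_lt_nat D) fun k _ => hlenfin k).subset ?_
    intro w hw
    simp only [Set.mem_iUnion]
    exact ⟨_, hw, rfl⟩
  refine toIdealOp_mem_fcFilter _ (Submodule.fg_span hVfin) (le_of_isLead ?_)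
  intro t _ w _
  by_cases hw : w.toList.length < D
  · exact ⟨wmon K w, Submodule.mem_sup_right (Submodule.subset_span ⟨w, hw, rfl⟩), trivial,
      isLead_wmon w⟩
  obtain ⟨i, a, hia⟩ : ∃ i a, w = c i * a := by
    have hw' : w = FreeMonoid.ofList (w.toList.take D) * FreeMonoid.ofList (w.toList.drop D) := by
      apply FreeMonoid.toList.injective
      rw [FreeMonoid.toList_mul]
      exact (List.take_append_drop D _).symm
    by_cases h : ∃ p ∈ P, ∃ a, FreeMonoid.ofList (w.toList.take D) = p * a
    · obtain ⟨p, hp, a, ha⟩ := h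
      exact ⟨Sum.inl ⟨p, hp⟩, a * _, by rw [← mul_assoc]; exact hw'.trans (by rw [ha]; rfl)⟩
    · push Not at h
      refine ⟨Sum.inr ⟨_, ?_, h⟩, _, hw'⟩
      show (w.toList.take D).length = D
      rw [List.length_take]
      omega
  refine ⟨x i * wmon K a, Submodule.mem_sup_left ?_, trivial, hia ▸ (hx i).mul (isLead_wmon a)⟩
  exact Submodule.smul_mem _ (op (wmon K a)) (Submodule.subset_span ⟨i, rfl⟩)

end Hall

/-! ### Dual bases and idempotents in the fc-localization -/

section FCLocalization

variable {K : Type u} [Field K] {n : ℕ}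

/-- Otherwise `A` would be finite dimensional, but there are infinitely many words on at least one
letter. -/
theorem exists_ne_zero_of_mem_fcFilter (hn : 1 ≤ n) {J : Ideal (FreeAlgebra K (Fin n))ᵐᵒᵖ}
    (hJ : J ∈ fcFilter K (FreeAlgebra K (Fin n))) : ∃ x, op x ∈ J ∧ x ≠ 0 := by
  by_contra! h
  have hbot : J = ⊥ := by
    rw [eq_bot_iff]
    intro s hs
    rw [Submodule.mem_bot, ← op_unop s, h s.unop hs, op_zero]
  rw [mem_fcFilter, hbot, Submodule.restrictScalars_bot] at hJ
  have h1 : (⊤ : Submodule K (FreeAlgebra K (Fin n))ᵐᵒᵖ).FG :=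
    Submodule.CoFG.fg_of_isCompl isCompl_bot_top hJ
  have h2 : Module.Finite K (FreeAlgebra K (Fin n))ᵐᵒᵖ := ⟨h1⟩
  have h3 : Module.Finite K (FreeAlgebra K (Fin n)) :=
    Module.Finite.equiv (opLinearEquiv K : FreeAlgebra K (Fin n) ≃ₗ[K] _).symm
  have h4 : Finite (FreeMonoid (Fin n)) :=
    Module.Finite.finite_basis (FreeAlgebra.basisFreeMonoid K (Fin n))
  have : Nonempty (Fin n) := ⟨⟨0, hn⟩⟩
  have h5 : Infinite (List (Fin n)) := inferInstance
  exact h5.not_finite h4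

theorem isFaithfulFilter_fcFilter (hn : 1 ≤ n) :
    IsFaithfulFilter (fcFilter K (FreeAlgebra K (Fin n))) := by
  intro J hJ a ha
  obtain ⟨x, hx, hx0⟩ := exists_ne_zero_of_mem_fcFilter hn hJ
  exact (mul_eq_zero.mp (ha x hx)).resolve_right hx0

/-- The finite codimensional right ideals are finitely generated. -/
theorem exists_fg_of_mem_fcFilter {J : Ideal (FreeAlgebra K (Fin n))ᵐᵒᵖ}
    (hJ : J ∈ fcFilter K (FreeAlgebra K (Fin n))) :
    ∃ M : Submodule (FreeAlgebra K (Fin n))ᵐᵒᵖ (FreeAlgebra K (Fin n)),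
      M.FG ∧ toIdealOp M = J := by
  have hJfg : J.FG := by
    refine fg_of_finite_codim (K := K)
      (s := MulOpposite.unop ⁻¹' Set.range (FreeAlgebra.ι K : Fin n → _)) ?_ ?_ hJ
    · exact (Set.finite_range _).preimage unop_injective.injOn
    · rw [← Subalgebra.op_adjoin, FreeAlgebra.adjoin_range_ι, Subalgebra.op_top]
  let U : (FreeAlgebra K (Fin n))ᵐᵒᵖ →ₗ[(FreeAlgebra K (Fin n))ᵐᵒᵖ] FreeAlgebra K (Fin n) :=
    { toFun := unop
      map_add' := fun _ _ => rfl
      map_smul' := fun _ _ => rfl }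
  refine ⟨Submodule.map U J, Submodule.FG.map U hJfg, ?_⟩
  ext s
  constructor
  · rintro ⟨t, ht, e⟩
    rw [← unop_injective (show unop t = unop s from e)]
    exact ht
  · intro hs
    exact ⟨s, hs, rfl⟩

/-- A basis of a finite codimensional right ideal has a dual basis in the localization. -/
theorem exists_dual_basis (hn : 1 ≤ n) {ι : Type*} [Fintype ι] [DecidableEq ι]
    {x : ι → FreeAlgebra K (Fin n)}
    (hx : LinearIndependent (FreeAlgebra K (Fin n))ᵐᵒᵖ x)
    (hJ : toIdealOp (Submodule.span (FreeAlgebra K (Fin n))ᵐᵒᵖ (Set.range x)) ∈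
      fcFilter K (FreeAlgebra K (Fin n))) :
    ∃ y : ι → Qfc K n, (∀ i j, y i * toQfc K n (x j) = if i = j then 1 else 0) ∧
      ∑ i, toQfc K n (x i) * y i = 1 := by
  classical
  have huniq : ∀ g g' : ι → FreeAlgebra K (Fin n), ∑ i, x i * g i = ∑ i, x i * g' i → g = g' := by
    intro g g' h
    have := Fintype.linearIndependent_iff.mp hx (fun i => op (g i - g' i)) (by
      rw [← sub_eq_zero, ← Finset.sum_sub_distrib] at h
      rw [← h]
      exact Finset.sum_congr rfl fun i _ => mul_sub _ _ _)
    ext i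
    have := congrArg unop (this i)
    exact sub_eq_zero.mp this
  have hex : ∀ z, z ∈ Submodule.span (FreeAlgebra K (Fin n))ᵐᵒᵖ (Set.range x) →
      ∃ g : ι → FreeAlgebra K (Fin n), z = ∑ i, x i * g i := by
    intro z hz
    obtain ⟨g, hg⟩ := (Submodule.mem_span_range_iff_exists_fun _).mp hz
    exact ⟨fun i => (g i).unop, hg.symm⟩
  -- The coordinates with respect to `x`, with dummy value 0 outside the span; each defines an
  -- element of the localization.
  let c : FreeAlgebra K (Fin n) → ι → FreeAlgebra K (Fin n) := fun z =>
    if h : ∃ g : ι → FreeAlgebra K (Fin n), z = ∑ i, x i * g i then h.choose else 0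
  have hc : ∀ z, z ∈ Submodule.span (FreeAlgebra K (Fin n))ᵐᵒᵖ (Set.range x) →
      z = ∑ i, x i * c z i := by
    intro z hz
    simp only [c, dif_pos (hex z hz)]
    exact (hex z hz).choose_spec
  have hy : ∀ i, ∃ y : Qfc K n, ∀ z, z ∈ Submodule.span (FreeAlgebra K (Fin n))ᵐᵒᵖ (Set.range x) →
      y * toQfc K n z = toQfc K n (c z i) := by
    intro i
    refine RightQuotients.exists_of_fun hJ (fun z => c z i) ?_ ?_
    · intro z z' hz hz'
      refine congrFun (huniq (c (z + z')) (c z + c z') ?_) i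
      rw [← hc (z + z') (Submodule.add_mem _ hz hz')]
      conv_lhs => rw [hc z hz, hc z' hz']
      rw [← Finset.sum_add_distrib]
      exact Finset.sum_congr rfl fun i _ => (mul_add _ _ _).symm
    · intro z r hz
      refine congrFun (huniq (c (z * r)) (fun i => c z i * r) ?_) i
      rw [← hc (z * r) (Submodule.smul_mem _ (op r) hz)]
      conv_lhs => rw [hc z hz]
      rw [Finset.sum_mul]
      exact Finset.sum_congr rfl fun i _ => mul_assoc _ _ _
  choose y hy using hy
  refine ⟨y, fun i j => ?_, ?_⟩
  · have hxj : x j ∈ Submodule.span (FreeAlgebra K (Fin n))ᵐᵒᵖ (Set.range x) :=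
      Submodule.subset_span ⟨j, rfl⟩
    rw [hy i (x j) hxj, huniq (c (x j)) (Pi.single j 1)]
    · rw [Pi.single_apply]
      split_ifs <;> simp
    · rw [← hc _ hxj]
      simp [Pi.single_apply]
  -- `∑ xᵢ yᵢ` fixes every element of a finite codimensional right ideal, as 1 does.
  · refine RightQuotients.eq_of_mul (isFaithfulFilter_fcFilter hn) hJ fun z hz => ?_
    rw [one_mul, Finset.sum_mul]
    conv_rhs => rw [hc z hz, map_sum]
    refine Finset.sum_congr rfl fun i _ => ?_
    rw [mul_assoc, hy i z hz, map_mul]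

/-- `J` is finitely generated, so it has a finite basis, and the dual basis supplies the
coefficients. -/
theorem exists_sum_eq_one_of_mem_fcFilter (hn : 1 ≤ n) {J : Ideal (FreeAlgebra K (Fin n))ᵐᵒᵖ}
    (hJ : J ∈ fcFilter K (FreeAlgebra K (Fin n))) :
    ∃ (m : ℕ) (x : Fin m → FreeAlgebra K (Fin n)) (c : Fin m → Qfc K n), (∀ k, op (x k) ∈ J) ∧
      ∑ k, toQfc K n (x k) * c k = 1 := by
  classical
  obtain ⟨M, hM, rfl⟩ := exists_fg_of_mem_fcFilter hJ
  obtain ⟨C₁, C₂, _, _, x, hx, hspan, -⟩ := exists_basis_extension M hM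
  have := Fintype.ofFinite C₁
  have hli := hx.comp Sum.inl Sum.inl_injective
  rw [← hspan] at hJ
  obtain ⟨y, -, hy⟩ := exists_dual_basis hn hli hJ
  let e := Fintype.equivFin C₁
  refine ⟨Fintype.card C₁, fun k => x (Sum.inl (e.symm k)), fun k => y (e.symm k), fun k => ?_, ?_⟩
  · rw [op_mem_toIdealOp, ← hspan]
    exact Submodule.subset_span ⟨_, rfl⟩
  · rw [← hy]
    exact Fintype.sum_equiv e.symm _ _ fun _ => rfl

/-- Every principal right ideal of the localization is generated by an idempotent `∑ xᵢ yᵢ`,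
where `yᵢ xⱼ = δᵢⱼ`. -/
theorem exists_factorization (hn : 1 ≤ n) (q : Qfc K n) :
    ∃ (r : ℕ) (x y : Fin r → Qfc K n) (p : Qfc K n),
      (∀ i j, y i * x j = if i = j then 1 else 0) ∧ (∑ i, x i * y i) * q = q ∧
      ∑ i, x i * y i = q * p := by
  classical
  have hI := RightQuotients.numerators_mem q
  obtain ⟨N, ⟨S, hS⟩, hN⟩ := exists_fg_of_mem_fcFilter hI
  have hex : ∀ z ∈ N, ∃ a, q * toQfc K n z = toQfc K n a := by
    intro z hz
    rw [← op_mem_toIdealOp, hN] at hz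
    exact hz
  choose a ha using fun z : S => hex z.1 (hS ▸ Submodule.subset_span z.2)
  -- The span of `a` is `q I`, for `I` the ideal of denominators of `q`. It may have infinite
  -- codimension, so its coordinate functions become elements of `Q` only after the basis is
  -- extended. The idempotent sums over `C₁` alone.
  obtain ⟨C₁, C₂, _, _, x, hx, hspan, hJ⟩ :=
    exists_basis_extension (Submodule.span (FreeAlgebra K (Fin n))ᵐᵒᵖ (Set.range a))
      (Submodule.fg_span (Set.finite_range a))
  have := Fintype.ofFinite C₁
  have := Fintype.ofFinite C₂
  obtain ⟨y, hyx, -⟩ := exists_dual_basis hn hx hJ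
  let φ := toQfc K n
  let e := Fintype.equivFin C₁
  have hsum : ∑ i, φ (x (Sum.inl (e.symm i))) * y (Sum.inl (e.symm i)) =
      ∑ c, φ (x (Sum.inl c)) * y (Sum.inl c) := Fintype.sum_equiv e.symm _ _ fun _ => rfl
  have hdiv : ∀ c, ∃ p, φ (x (Sum.inl c)) = q * p := by
    intro c
    have : x (Sum.inl c) ∈ Submodule.span (FreeAlgebra K (Fin n))ᵐᵒᵖ (Set.range a) := by
      rw [← hspan]; exact Submodule.subset_span ⟨c, rfl⟩
    obtain ⟨g, hg⟩ := (Submodule.mem_span_range_iff_exists_fun _).mp this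
    refine ⟨∑ z : S, φ z.1 * φ (g z).unop, ?_⟩
    rw [← hg, map_sum, Finset.mul_sum]
    refine Finset.sum_congr rfl fun z _ => ?_
    rw [← mul_assoc, ha, ← map_mul]
    rfl
  choose p hp using hdiv
  refine ⟨Fintype.card C₁, fun i => φ (x (Sum.inl (e.symm i))), fun i => y (Sum.inl (e.symm i)),
    ∑ c, p c * y (Sum.inl c), fun i j => ?_, ?_, ?_⟩
  · rw [hyx]
    simp
  · rw [hsum]
    -- For `z ∈ I` the element `q z` lies in the span of the `C₁` part, where the partial sum acts
    -- as the identity.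
    refine RightQuotients.eq_of_mul (isFaithfulFilter_fcFilter hn) hI fun z hz => ?_
    have hz' : z ∈ N := by rw [← hN] at hz; exact hz
    rw [← hS] at hz'
    obtain ⟨m, hm, hqz⟩ : ∃ m ∈ Submodule.span (FreeAlgebra K (Fin n))ᵐᵒᵖ (Set.range a),
        q * φ z = φ m := by
      obtain ⟨g, -, hg⟩ := Submodule.mem_span_finset.mp hz'
      rw [← Finset.sum_coe_sort S fun z => g z • z] at hg
      refine ⟨∑ z : S, a z * (g z).unop, ?_, ?_⟩
      · exact sum_mem fun z _ => Submodule.smul_mem _ (g z) (Submodule.subset_span ⟨z, rfl⟩)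
      · rw [← hg, map_sum, map_sum, Finset.mul_sum]
        refine Finset.sum_congr rfl fun z _ => ?_
        rw [map_mul φ, ← ha, mul_assoc, ← map_mul]
        rfl
    rw [mul_assoc, show q * RightQuotients.ofRing _ z = φ m from hqz]
    rw [← hspan] at hm
    obtain ⟨g, hg⟩ := (Submodule.mem_span_range_iff_exists_fun _).mp hm
    have hm' : φ m = ∑ d, φ (x (Sum.inl d)) * φ (g d).unop := by
      rw [← hg, map_sum]
      exact Finset.sum_congr rfl fun d _ => map_mul φ _ _
    have hym : ∀ c, y (Sum.inl c) * φ m = φ (g c).unop := by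
      intro c
      rw [hm', Finset.mul_sum, Finset.sum_eq_single c]
      · rw [← mul_assoc, hyx, if_pos rfl, one_mul]
      · intro d _ hd
        rw [← mul_assoc, hyx, if_neg (fun e => hd (Sum.inl_injective e).symm), zero_mul]
      · simp
    rw [Finset.sum_mul]
    conv_rhs => rw [hm']
    exact Finset.sum_congr rfl fun c _ => by rw [mul_assoc, hym]
  · rw [hsum, Finset.mul_sum]
    exact Finset.sum_congr rfl fun c _ => by rw [hp, mul_assoc]

end FCLocalization

/-! ### Flat bimorphisms of free algebras -/

section FlatOverFree

variable {K : Type u} [Field K] {n : ℕ} {B : Type v} [Ring B] {ψ : FreeAlgebra K (Fin n) →+* B}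

/-- A finitely generated right ideal `M` with `M B = B` has finite codimension if `B` is flat. -/
theorem toIdealOp_mem_fcFilter_of_flat [Nontrivial B] [Module (FreeAlgebra K (Fin n)) B]
    (hsmul : ∀ (a : FreeAlgebra K (Fin n)) (b : B), a • b = ψ a * b)
    (hflat : IsFlatLeftModule (FreeAlgebra K (Fin n)) B) {m : ℕ}
    {z : Fin m → FreeAlgebra K (Fin n)} {c : Fin m → B} (hc : ∑ k, ψ (z k) * c k = 1) :
    toIdealOp (Submodule.span (FreeAlgebra K (Fin n))ᵐᵒᵖ (Set.range z)) ∈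
      fcFilter K (FreeAlgebra K (Fin n)) := by
  classical
  obtain ⟨C₁, C₂, _, _, x, hx, hspan, hJ⟩ :=
    exists_basis_extension (Submodule.span (FreeAlgebra K (Fin n))ᵐᵒᵖ (Set.range z))
      (Submodule.fg_span (Set.finite_range z))
  have := Fintype.ofFinite C₁
  have := Fintype.ofFinite C₂
  rcases isEmpty_or_nonempty C₂ with hC | ⟨⟨d⟩⟩
  · have hr : Set.range (x ∘ Sum.inl) = Set.range x := by
      refine Set.Subset.antisymm (Set.range_comp_subset_range _ _) ?_
      rintro _ ⟨i | i, rfl⟩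
      · exact ⟨i, rfl⟩
      · exact hC.elim i
    rw [← hspan, hr]
    exact hJ
  -- The extra basis element `y = x_d` equals `∑ xᵢ (bᵢ y)` over `C₁`, because `∑ xᵢ bᵢ = 1`. So two
  -- tensors of the free module on `x` have the same image in `A ⊗ B`. Flatness equates them, and
  -- their `d` coordinates say `0 = 1`.
  exfalso
  obtain ⟨b, hb⟩ : ∃ b : C₁ → B, ∑ i, ψ (x (Sum.inl i)) * b i = 1 := by
    have : ∀ k, ∃ g : C₁ → FreeAlgebra K (Fin n), z k = ∑ i, x (Sum.inl i) * g i := by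
      intro k
      have : z k ∈ Submodule.span (FreeAlgebra K (Fin n))ᵐᵒᵖ (Set.range (x ∘ Sum.inl)) := by
        rw [hspan]; exact Submodule.subset_span ⟨k, rfl⟩
      obtain ⟨g, hg⟩ := (Submodule.mem_span_range_iff_exists_fun _).mp this
      exact ⟨fun i => (g i).unop, hg.symm⟩
    choose g hg using this
    refine ⟨fun i => ∑ k, ψ (g k i) * c k, ?_⟩
    rw [← hc]
    simp only [Finset.mul_sum]
    rw [Finset.sum_comm]
    refine Finset.sum_congr rfl fun k _ => ?_
    conv_rhs => rw [hg k, map_sum, Finset.sum_mul]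
    exact Finset.sum_congr rfl fun i _ => by rw [map_mul, mul_assoc]
  let A := FreeAlgebra K (Fin n)
  let T : ((C₁ ⊕ C₂) → A) →ₗ[Aᵐᵒᵖ] A :=
    { toFun := fun f => ∑ i, x i * f i
      map_add' := fun f g => by simp [mul_add, Finset.sum_add_distrib]
      map_smul' := fun r f => by
        rw [Finset.smul_sum]
        exact Finset.sum_congr rfl fun i _ => (mul_assoc _ _ _).symm }
  have hT : Function.Injective T := by
    rw [injective_iff_map_eq_zero]
    intro f hf
    ext i
    exact congrArg unop (Fintype.linearIndependent_iff.mp hx (fun i => op (f i)) hf i)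
  have hT1 : ∀ i, T (Pi.single i 1) = x i := fun i => by
    show ∑ j, x j * (Pi.single i 1 : C₁ ⊕ C₂ → A) j = x i
    simp [Pi.single_apply]
  let y : A := x (Sum.inr d)
  let E : BalancedTensor A (C₁ ⊕ C₂ → A) B :=
    ∑ i : C₁, BalancedTensor.tmul (Pi.single (Sum.inl i) 1) (b i * ψ y)
  have h1 : ∀ (a : A) (β : B), BalancedTensor.tmul (A := A) a β =
      BalancedTensor.tmul (1 : A) (ψ a * β) := fun a β => by
    rw [← hsmul, ← BalancedTensor.smul_tmul, op_smul_eq_mul, one_mul]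
  have hE : BalancedTensor.map T B E =
      BalancedTensor.map T B (BalancedTensor.tmul (Pi.single (Sum.inr d) 1) 1) := by
    simp only [E, map_sum, BalancedTensor.map_tmul, hT1]
    simp only [h1 (x _)]
    rw [← BalancedTensor.tmul_sum]
    congr 1
    simp only [← mul_assoc]
    rw [← Finset.sum_mul, hb, one_mul, mul_one]
  have hE' := hflat _ _ T hT hE
  let π : BalancedTensor A (C₁ ⊕ C₂ → A) B →+ B :=
    BalancedTensor.lift (AddMonoidHom.mk' (fun f => AddMonoidHom.mulLeft (ψ (f (Sum.inr d))))
      (by intro f g; ext β; simp [add_mul])) (by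
        intro f a β
        show ψ (f (Sum.inr d) * a) * β = ψ (f (Sum.inr d)) * (a • β)
        rw [hsmul, map_mul, mul_assoc])
  have hπ : ∀ f β, π (BalancedTensor.tmul f β) = ψ (f (Sum.inr d)) * β := fun f β => rfl
  have := congrArg π hE'
  simp only [E, map_sum, hπ] at this
  simp at this

/-- Finitely many numerators already generate the unit right ideal of `B`, and the right ideal of
`A` that they span has finite codimension. -/
theorem numerators_mem_fcFilter_of_flat (hψ : IsFlatBimorphism ψ) (b : B) :
    numerators ψ b ∈ fcFilter K (FreeAlgebra K (Fin n)) := by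
  let _ : Module (FreeAlgebra K (Fin n)) B := Module.compHom B ψ
  have : Nontrivial B := hψ.1.nontrivial
  obtain ⟨m, x, c, hx, hc⟩ := exists_numerators_sum_eq_one (fun _ _ => rfl) hψ.2.1 hψ.2.2 b
  refine Order.PFilter.mem_of_le ?_ (toIdealOp_mem_fcFilter_of_flat (fun _ _ => rfl) hψ.2.2 hc)
  intro s hs
  obtain ⟨g, hg⟩ := (Submodule.mem_span_range_iff_exists_fun _).mp
    (show s.unop ∈ Submodule.span (FreeAlgebra K (Fin n))ᵐᵒᵖ (Set.range x) from hs)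
  have : s = ∑ k, g k • op (x k) := by
    apply unop_injective
    rw [← hg, Finset.unop_sum]
    rfl
  rw [this]
  exact sum_mem fun k _ => Submodule.smul_mem _ _ (hx k)

end FlatOverFree

/-! ### Universal property, simplicity and principal ideals -/

section TotalQuotients

variable {K : Type u} [Field K] {n : ℕ}

theorem isFaithfulFilter_denseFilter (A : Type u) [Ring A] :
    IsFaithfulFilter (denseFilter A) := by
  intro J hJ a ha
  by_contra ha0
  obtain ⟨r, hr, har⟩ := hJ 1 a ha0
  rw [one_mul] at hr
  exact har (ha r hr)

/-- The colon ideal of `J` by `a` again has finite codimension, so it contains some `r ≠ 0`; and `b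
r ≠ 0` in a domain. -/
theorem mem_denseFilter_of_mem_fcFilter (hn : 1 ≤ n) {J : Ideal (FreeAlgebra K (Fin n))ᵐᵒᵖ}
    (hJ : J ∈ fcFilter K (FreeAlgebra K (Fin n))) : J ∈ denseFilter (FreeAlgebra K (Fin n)) := by
  intro a b hb
  obtain ⟨r, hr, hr0⟩ := exists_ne_zero_of_mem_fcFilter hn (IdealFilter.IsUniform.colon_mem hJ (op a))
  exact ⟨r, Submodule.mem_colon_singleton.mp hr, mul_ne_zero hb hr0⟩

theorem isFlatBimorphism_toQfc (hn : 1 ≤ n) : IsFlatBimorphism (toQfc K n) :=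
  isFlatBimorphism_of_numerators (RightQuotients.ofRing_injective (isFaithfulFilter_fcFilter hn))
    RightQuotients.numerators_mem fun _ hJ => exists_sum_eq_one_of_mem_fcFilter hn hJ

theorem exists_mul_eq_ne_zero {A : Type u} [Ring A] {B : Type v} [Ring B] {ψ : A →+* B} {b : B}
    (h : ∃ (m : ℕ) (x : Fin m → A) (c : Fin m → B), (∀ k, op (x k) ∈ numerators ψ b) ∧
      ∑ k, ψ (x k) * c k = 1) (hb : b ≠ 0) : ∃ x a : A, b * ψ x = ψ a ∧ a ≠ 0 := by
  obtain ⟨m, x, c, hx, hc⟩ := h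
  by_contra! h0
  apply hb
  rw [← mul_one b, ← hc, Finset.mul_sum]
  refine Finset.sum_eq_zero fun k _ => ?_
  obtain ⟨a, ha⟩ := mem_numerators.mp (hx k)
  rw [← mul_assoc, ha, h0 _ a ha, map_zero, zero_mul]

theorem exists_lift_of_isFlatBimorphism (hn : 1 ≤ n) {B : Type v} [Ring B]
    {ψ : FreeAlgebra K (Fin n) →+* B} (hψ : IsFlatBimorphism ψ) :
    ∃ h : B →+* Qfc K n, Function.Injective h ∧ h.comp ψ = toQfc K n ∧
      ∀ h' : B →+* Qfc K n, h'.comp ψ = toQfc K n → h' = h := by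
  have hF := isFaithfulFilter_fcFilter (K := K) hn
  have hnum := numerators_mem_fcFilter_of_flat hψ
  obtain ⟨g, hg⟩ := RightQuotients.exists_lift hF hψ.1 hnum
  refine ⟨g, RightQuotients.lift_injective hF (fun b hb => ?_) hg, hg, fun g' hg' =>
    RightQuotients.lift_unique hF hnum hg' hg⟩
  let _ : Module (FreeAlgebra K (Fin n)) B := Module.compHom B ψ
  exact exists_mul_eq_ne_zero
    (exists_numerators_sum_eq_one (fun _ _ => rfl) hψ.2.1 hψ.2.2 b) hb

/-- Numerator ideals of `Q` are dense, which gives `j`. A competing subring `T` maps to `Q` by the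
universal property. The composite with `j` is the inclusion of `T`, since maps into `Q_max` that
agree on `A` coincide when numerator ideals are dense. -/
theorem exists_isQtot (hn : 1 ≤ n) :
    ∃ j : Qfc K n →+* Qmax (FreeAlgebra K (Fin n)), Function.Injective j ∧
      j.comp (toQfc K n) = toQmax (FreeAlgebra K (Fin n)) ∧
      IsQtot (FreeAlgebra K (Fin n)) j.range := by
  have hF := isFaithfulFilter_fcFilter (K := K) hn
  have hD := isFaithfulFilter_denseFilter (FreeAlgebra K (Fin n))
  have hinj := RightQuotients.ofRing_injective hF
  have hinjD := RightQuotients.ofRing_injective hD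
  obtain ⟨j, hj⟩ := RightQuotients.exists_lift hD hinj
    fun q => mem_denseFilter_of_mem_fcFilter hn (RightQuotients.numerators_mem q)
  have hj' : ∀ a, j (toQfc K n a) = toQmax _ a := fun a => congrArg (fun g => g a) hj
  have hjinj : Function.Injective j := RightQuotients.lift_injective hD (fun q hq =>
    exists_mul_eq_ne_zero (exists_sum_eq_one_of_mem_fcFilter hn
      (RightQuotients.numerators_mem q)) hq) hj
  refine ⟨j, hjinj, hj, ⟨fun a => ⟨_, hj' a⟩, ?_⟩, ?_⟩
  · refine isFlatBimorphism_of_numerators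
      (F := fcFilter K (FreeAlgebra K (Fin n))) ?_ ?_ ?_
    · intro a a' h
      exact hinjD (congrArg Subtype.val h)
    · rintro ⟨_, q, rfl⟩
      refine Order.PFilter.mem_of_le ?_ (RightQuotients.numerators_mem q)
      rintro s ⟨a, ha⟩
      refine ⟨a, Subtype.ext ?_⟩
      show j q * toQmax _ s.unop = toQmax _ a
      rw [← hj', ← hj', ← map_mul]
      exact congrArg j ha
    · intro J hJ
      obtain ⟨m, x, c, hx, hc⟩ := exists_sum_eq_one_of_mem_fcFilter hn hJ
      refine ⟨m, x, fun k => ⟨j (c k), c k, rfl⟩, hx, Subtype.ext ?_⟩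
      rw [AddSubmonoidClass.coe_finsetSum]
      show ∑ k, toQmax _ (x k) * j (c k) = 1
      simp only [← hj', ← map_mul, ← map_sum]
      rw [hc, map_one]
  · rintro T ⟨hT, hflat⟩ t ht
    have hnum := numerators_mem_fcFilter_of_flat hflat
    obtain ⟨g, hg⟩ := RightQuotients.exists_lift hF hflat.1 hnum
    have : T.subtype = j.comp g := by
      refine RightQuotients.lift_unique hD
        (fun b => mem_denseFilter_of_mem_fcFilter hn (hnum b)) (ψ := (toQmax _).codRestrict T hT)
        ?_ ?_
      · rfl
      · rw [RingHom.comp_assoc, hg, hj]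
    exact ⟨g ⟨t, ht⟩, (congrArg (fun f : T →+* Qmax _ => f ⟨t, ht⟩) this).symm⟩

/-- For `q ≠ 0` the idempotent `∑ xᵢ yᵢ = q p` has at least one summand, and `y₀ (q p) x₀ = 1`. -/
theorem isSimpleRing_Qfc (hn : 1 ≤ n) : IsSimpleRing (Qfc K n) := by
  have hinj := RightQuotients.ofRing_injective (isFaithfulFilter_fcFilter (K := K) hn)
  have : Nontrivial (Qfc K n) := hinj.nontrivial
  refine isSimpleRing_iff_isTwoSided_imp.mpr ⟨this, fun I hI => or_iff_not_imp_left.mpr fun hbot => ?_⟩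
  obtain ⟨q, hq, hq0⟩ := Submodule.exists_mem_ne_zero_of_ne_bot hbot
  obtain ⟨r, x, y, p, hyx, heq, hep⟩ := exists_factorization hn q
  have hr : 0 < r := by
    by_contra h0
    obtain rfl : r = 0 := by omega
    exact hq0 (by rw [← heq]; simp)
  let i : Fin r := ⟨0, hr⟩
  have h1 : y i * (q * p) * x i = 1 := by
    rw [← hep, Finset.mul_sum, Finset.sum_mul, Finset.sum_eq_single i]
    · rw [← mul_assoc, hyx, if_pos rfl, one_mul, hyx, if_pos rfl]
    · intro j _ hj
      rw [← mul_assoc, hyx, if_neg (Ne.symm hj), zero_mul, zero_mul]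
    · simp
  rw [Ideal.eq_top_iff_one, ← h1]
  exact I.mul_mem_right _ (I.mul_mem_left _ (I.mul_mem_right _ hq))

theorem exists_regular_Qfc (hn : 1 ≤ n) (q : Qfc K n) : ∃ p, q * p * q = q := by
  obtain ⟨r, x, y, p, -, heq, hep⟩ := exists_factorization hn q
  exact ⟨p, by rw [← hep, heq]⟩

theorem free_span_singleton_of_basis {R : Type u} [Ring R] {a : R} {r : ℕ} {v : Fin r → R}
    (hv : LinearIndependent R v) (hspan : Submodule.span R (Set.range v) = Submodule.span R {a}) :
    Module.Free R (Submodule.span R {a}) :=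
  hspan ▸ Module.Free.of_basis (Module.Basis.span hv)

/-- The elements `yᵢ q` form a basis: right multiplication by `p xⱼ` reads off coordinates, since `q
p xⱼ = xⱼ`. -/
theorem free_left_span_Qfc (hn : 1 ≤ n) (q : Qfc K n) :
    Module.Free (Qfc K n) (Submodule.span (Qfc K n) {q}) := by
  obtain ⟨r, x, y, p, hyx, heq, hep⟩ := exists_factorization hn q
  have hex : ∀ j, (q * p) * x j = x j := by
    intro j
    rw [← hep, Finset.sum_mul, Finset.sum_eq_single j]
    · rw [mul_assoc, hyx, if_pos rfl, mul_one]
    · intro i _ hi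
      rw [mul_assoc, hyx, if_neg hi, mul_zero]
    · simp
  refine free_span_singleton_of_basis (v := fun i => y i * q) ?_ (le_antisymm ?_ ?_)
  · rw [Fintype.linearIndependent_iff]
    intro c hc j
    have h1 := congrArg (· * (p * x j)) hc
    simp only [smul_eq_mul, Finset.sum_mul, zero_mul] at h1
    rw [Finset.sum_eq_single j] at h1
    · rwa [mul_assoc, mul_assoc, ← mul_assoc q, hex, hyx, if_pos rfl, mul_one] at h1
    · intro i _ hi
      rw [mul_assoc, mul_assoc, ← mul_assoc q, hex, hyx, if_neg hi, mul_zero]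
    · simp
  · rw [Submodule.span_le]
    rintro _ ⟨i, rfl⟩
    exact Submodule.smul_mem _ (y i) (Submodule.mem_span_singleton_self q)
  · rw [Submodule.span_singleton_le_iff_mem, ← heq, Finset.sum_mul]
    refine sum_mem fun i _ => ?_
    rw [mul_assoc]
    refine Submodule.smul_mem _ (x i) (Submodule.subset_span ⟨i, ?_⟩)
    change y i * _ = y i * q
    rw [← Finset.sum_mul, heq]

/-- Here `q Q` has the basis `xᵢ`, with left multiplication by `yⱼ` as coordinate functions. -/
theorem free_right_span_Qfc (hn : 1 ≤ n) (q : (Qfc K n)ᵐᵒᵖ) :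
    Module.Free (Qfc K n)ᵐᵒᵖ (Submodule.span (Qfc K n)ᵐᵒᵖ {q}) := by
  obtain ⟨r, x, y, p, hyx, heq, hep⟩ := exists_factorization hn q.unop
  have hex : ∀ j, (q.unop * p) * x j = x j := by
    intro j
    rw [← hep, Finset.sum_mul, Finset.sum_eq_single j]
    · rw [mul_assoc, hyx, if_pos rfl, mul_one]
    · intro i _ hi
      rw [mul_assoc, hyx, if_neg hi, mul_zero]
    · simp
  refine free_span_singleton_of_basis (v := fun i => op (x i)) ?_ (le_antisymm ?_ ?_)
  · rw [Fintype.linearIndependent_iff]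
    intro c hc j
    have h1 := congrArg (fun z => y j * z.unop) hc
    simp only [smul_eq_mul, Finset.unop_sum, unop_mul, unop_op, Finset.mul_sum, unop_zero,
      mul_zero, ← mul_assoc, hyx] at h1
    simpa using h1
  · rw [Submodule.span_le]
    rintro _ ⟨i, rfl⟩
    refine Submodule.mem_span_singleton.mpr ⟨op (p * x i), ?_⟩
    apply unop_injective
    show q.unop * (p * x i) = x i
    rw [← mul_assoc, hex]
  · rw [Submodule.span_singleton_le_iff_mem]
    have : q = ∑ i, op (y i * q.unop) • op (x i) := by
      apply unop_injective
      rw [Finset.unop_sum]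
      conv_lhs => rw [← heq, Finset.sum_mul]
      exact Finset.sum_congr rfl fun i _ => mul_assoc _ _ _
    rw [this]
    exact sum_mem fun i _ => Submodule.smul_mem _ _ (Submodule.subset_span ⟨i, rfl⟩)

end TotalQuotients

/-! ### Projective modules over von Neumann regular rings -/

section Projectives

variable {R : Type u} [Ring R]

section Filtration

variable {M : Type w} [AddCommGroup M] [Module R M]

/-- A basis of a submodule extends to a basis of a larger submodule if the quotient is free. -/
theorem exists_linearIndepOn_extension {t : Set M} (ht : LinearIndepOn R id t)
    {N' : Submodule R M} (hN : Submodule.span R t ≤ N')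
    (hfree : Module.Free R (N'.map (Submodule.span R t).mkQ)) :
    ∃ t' : Set M, t ⊆ t' ∧ LinearIndepOn R id t' ∧ Submodule.span R t' = N' := by
  set N := Submodule.span R t with hNdef
  let β := Module.Free.chooseBasis R (N'.map N.mkQ)
  have hex : ∀ i, ∃ g ∈ N', N.mkQ g = β i := fun i => (β i).2
  choose g hg hgβ using hex
  have hli : LinearIndependent R (N.mkQ ∘ g) := by
    have h1 := β.linearIndependent.map' (N'.map N.mkQ).subtype (Submodule.ker_subtype _)
    have h2 : N.mkQ ∘ g = (N'.map N.mkQ).subtype ∘ β := funext fun i => hgβ i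
    rw [h2]
    exact h1
  have hli' : LinearIndepOn R N.mkQ (Set.range g) := by
    rcases subsingleton_or_nontrivial R with _ | _
    · exact linearIndependent_of_subsingleton
    · exact (linearIndepOn_range_iff hli.injective.of_comp _).mpr hli
  refine ⟨t ∪ Set.range g, Set.subset_union_left,
    LinearIndepOn.union_id_of_quotient Submodule.subset_span ht hli', ?_⟩
  rw [Submodule.span_union, ← hNdef]
  refine le_antisymm (sup_le hN (Submodule.span_le.mpr (Set.range_subset_iff.mpr hg))) ?_
  have h3 : N'.map N.mkQ = (Submodule.span R (Set.range g)).map N.mkQ := by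
    have h4 : Set.range (N.mkQ ∘ g) = (N'.map N.mkQ).subtype '' Set.range β := by
      rw [← Set.range_comp]
      exact congrArg _ (funext fun i => hgβ i)
    rw [Submodule.map_span, ← Set.range_comp, h4, ← Submodule.map_span, β.span_eq,
      Submodule.map_top, Submodule.range_subtype]
  have h5 := congrArg (Submodule.comap N.mkQ) h3
  rw [Submodule.comap_map_mkQ, Submodule.comap_map_mkQ] at h5
  exact le_sup_right.trans h5.le

/-- A module with a filtration, closed under unions, with free factors is free. -/
theorem free_of_filtration (𝒞 : Set (Submodule R M)) (hbot : ⊥ ∈ 𝒞)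
    (hchain : ∀ c ⊆ 𝒞, IsChain (· ≤ ·) c → c.Nonempty → sSup c ∈ 𝒞)
    (hstep : ∀ N ∈ 𝒞, N ≠ ⊤ → ∃ N' ∈ 𝒞, N < N' ∧ Module.Free R (N'.map N.mkQ)) :
    Module.Free R M := by
  -- Zorn is applied to bases of members of `𝒞` rather than to the members, so that the bases along
  -- a chain are nested.
  let S : Set (Set M) := {t | LinearIndepOn R id t ∧ Submodule.span R t ∈ 𝒞}
  obtain ⟨t, -, ht⟩ := zorn_subset_nonempty S (by
    intro c hc hcc hcne
    refine ⟨⋃₀ c, ⟨?_, ?_⟩, fun s hs => Set.subset_sUnion_of_mem hs⟩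
    · exact linearIndepOn_sUnion_of_directed hcc.directedOn fun s hs => (hc hs).1
    · have h1 : Submodule.span R (⋃₀ c) = sSup (Submodule.span R '' c) := by
        rw [Set.sUnion_eq_biUnion, Submodule.span_iUnion₂, sSup_image]
      rw [h1]
      refine hchain _ ?_ ?_ (hcne.image _)
      · rintro _ ⟨s, hs, rfl⟩
        exact (hc hs).2
      · rintro _ ⟨s, hs, rfl⟩ _ ⟨s', hs', rfl⟩ hne
        rcases hcc.total hs hs' with h | h
        · exact Or.inl (Submodule.span_mono h)
        · exact Or.inr (Submodule.span_mono h)) ∅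
    ⟨linearIndepOn_empty R id, by rwa [Submodule.span_empty]⟩
  by_cases htop : Submodule.span R t = ⊤
  · exact Module.Free.of_basis (Module.Basis.mk (v := fun x : t => (x : M)) ht.1.1 (by
      rw [Subtype.range_coe]; exact htop.ge))
  · exfalso
    obtain ⟨N', hN', hlt, hfree⟩ := hstep _ ht.1.2 htop
    obtain ⟨t', htt', hli, hspan⟩ := exists_linearIndepOn_extension ht.1.1 hlt.le hfree
    have := ht.2 (y := t') ⟨hli, hspan ▸ hN'⟩ htt'
    exact hlt.not_ge (hspan ▸ Submodule.span_mono this)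

theorem projective_of_projective_quotient (W : Submodule R M) [Module.Projective R M]
    [Module.Projective R (M ⧸ W)] : Module.Projective R W := by
  obtain ⟨σ, hσ⟩ := Module.projective_lifting_property W.mkQ LinearMap.id
    (Submodule.mkQ_surjective W)
  have hσ' : ∀ x, W.mkQ (σ x) = x := fun x => congrArg (fun f => f x) hσ
  have hmem : ∀ x, (LinearMap.id - σ ∘ₗ W.mkQ : M →ₗ[R] M) x ∈ W := fun x => by
    refine (Submodule.Quotient.mk_eq_zero W).mp ?_
    change W.mkQ _ = 0
    simp only [LinearMap.sub_apply, LinearMap.comp_apply, map_sub, hσ', LinearMap.id_apply,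
      sub_self]
  refine Module.Projective.of_split W.subtype
    ((LinearMap.id - σ ∘ₗ W.mkQ).codRestrict W hmem) (LinearMap.ext fun x => Subtype.ext ?_)
  have : W.mkQ x = 0 := (Submodule.Quotient.mk_eq_zero W).mpr x.2
  change (x : M) - σ (W.mkQ x) = x
  rw [this, map_zero, sub_zero]

/-- Closedness of `S` means that `s` sends `span S` to families supported on `S`. Deleting those
coordinates makes `M / span S` a retract of the free module on the complement of `S`. -/
theorem projective_quotient_of_closed {s : M →ₗ[R] M →₀ R}
    (hs : (Finsupp.linearCombination R id) ∘ₗ s = LinearMap.id) {S : Set M}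
    (hS : ∀ m ∈ S, ∀ i, s m i ≠ 0 → i ∈ S) : Module.Projective R (M ⧸ Submodule.span R S) := by
  set N := Submodule.span R S
  let r : (M →₀ R) →ₗ[R] ((Sᶜ : Set M) →₀ R) := Finsupp.lsubtypeDomain Sᶜ
  have hr : ∀ m ∈ N, r (s m) = 0 := by
    intro m hm
    have : N ≤ LinearMap.ker (r ∘ₗ s) := by
      refine Submodule.span_le.mpr fun m hm => ?_
      show r (s m) = 0
      ext ⟨i, hi⟩
      show s m i = 0
      by_contra h
      exact hi (hS m hm i h)
    exact this hm
  refine Module.Projective.of_split (M := (Sᶜ : Set M) →₀ R) (N.liftQ (r ∘ₗ s) hr)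
    (Finsupp.linearCombination R fun i : (Sᶜ : Set M) => N.mkQ i) ?_
  apply Submodule.linearMap_qext
  ext m
  have key : ∀ f : M →₀ R, Finsupp.linearCombination R (fun i : (Sᶜ : Set M) => N.mkQ i) (r f) =
      N.mkQ (Finsupp.linearCombination R id f) := by
    intro f
    have : (Finsupp.linearCombination R (fun i : (Sᶜ : Set M) => N.mkQ i)) ∘ₗ r =
        N.mkQ ∘ₗ Finsupp.linearCombination R id := by
      ext i
      simp only [LinearMap.comp_apply, Finsupp.lsingle_apply, Finsupp.linearCombination_single,
        one_smul, id]
      by_cases hi : i ∈ S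
      · have h1 : r (Finsupp.single i 1) = 0 := by
          ext ⟨j, hj⟩
          show Finsupp.single i (1 : R) j = 0
          exact Finsupp.single_eq_of_ne (fun e => hj (e ▸ hi))
        rw [h1, map_zero]
        exact ((Submodule.Quotient.mk_eq_zero N).mpr (Submodule.subset_span hi)).symm
      · have h1 : r (Finsupp.single i 1) = Finsupp.single (⟨i, hi⟩ : (Sᶜ : Set M)) 1 := by
          ext ⟨j, hj⟩
          show Finsupp.single i (1 : R) j = _
          by_cases hij : i = j
          · subst hij; simp
          · rw [Finsupp.single_eq_of_ne' hij, Finsupp.single_eq_of_ne']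
            exact fun e => hij (congrArg Subtype.val e)
        rw [h1, Finsupp.linearCombination_single, one_smul]
    exact congrArg (fun g => g f) this
  exact (key (s m)).trans (congrArg (fun g => N.mkQ (g m)) hs)

end Filtration

/-- Every element lies in a countable set closed under supports. -/
theorem exists_countable_closed {X : Type*} (s : X → X →₀ R) (m : X) :
    ∃ T : Set X, T.Countable ∧ m ∈ T ∧ ∀ x ∈ T, ∀ i, s x i ≠ 0 → i ∈ T := by
  let T : ℕ → Set X := fun k => Nat.rec {m} (fun _ t => ⋃ x ∈ t, {i | s x i ≠ 0}) k
  have hT : ∀ k, T (k + 1) = ⋃ x ∈ T k, {i | s x i ≠ 0} := fun k => rfl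
  refine ⟨⋃ k, T k, Set.countable_iUnion fun k => ?_, Set.mem_iUnion.mpr ⟨0, rfl⟩, ?_⟩
  · induction k with
    | zero => exact Set.countable_singleton m
    | succ k ih =>
      rw [hT]
      refine ih.biUnion fun x _ => ?_
      refine (s x).support.countable_toSet.mono ?_
      intro i hi
      exact Finsupp.mem_support_iff.mpr hi
  · intro x hx i hi
    obtain ⟨k, hk⟩ := Set.mem_iUnion.mp hx
    refine Set.mem_iUnion.mpr ⟨k + 1, ?_⟩
    rw [hT]
    exact Set.mem_biUnion hk hi

/-- Kaplansky: if countably generated projective modules are free, so are all projective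
modules. -/
theorem projectivesAreFree_of_countable
    (h : ∀ (W : Type w) [AddCommGroup W] [Module R W] [Module.Projective R W] (p : ℕ → W),
      Submodule.span R (Set.range p) = ⊤ → Module.Free R W) : ProjectivesAreFree.{u, w} R := by
  intro M _ _ hM
  obtain ⟨s, hs⟩ := Module.projective_def'.mp hM
  let 𝒮 : Set (Set M) := {S | ∀ m ∈ S, ∀ i, s m i ≠ 0 → i ∈ S}
  refine free_of_filtration (Submodule.span R '' 𝒮) ⟨∅, ?_, Submodule.span_empty⟩ ?_ ?_
  · intro m hm
    exact hm.elim
  · intro c hc _ _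
    choose S hS hSN using fun N : c => hc N.2
    refine ⟨⋃ N, S N, ?_, ?_⟩
    · intro m hm i hi
      obtain ⟨N, hmN⟩ := Set.mem_iUnion.mp hm
      exact Set.mem_iUnion.mpr ⟨N, hS N m hmN i hi⟩
    · rw [Submodule.span_iUnion, sSup_eq_iSup']
      exact iSup_congr hSN
  · rintro _ ⟨S, hS, rfl⟩ htop
    obtain ⟨m, hm⟩ : ∃ m, m ∉ Submodule.span R S := by
      by_contra! hall
      exact htop (eq_top_iff.mpr fun x _ => hall x)
    obtain ⟨T, hTc, hmT, hT⟩ := exists_countable_closed s m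
    have hST : S ∪ T ∈ 𝒮 := by
      rintro x (hx | hx) i hi
      · exact Or.inl (hS x hx i hi)
      · exact Or.inr (hT x hx i hi)
    have hle : Submodule.span R S ≤ Submodule.span R (S ∪ T) :=
      Submodule.span_mono Set.subset_union_left
    refine ⟨_, ⟨S ∪ T, hST, rfl⟩, lt_of_le_of_ne hle ?_, ?_⟩
    · intro e
      exact hm (e ▸ Submodule.subset_span (Or.inr hmT))
    -- The factor `W` is the kernel of a surjection between projective modules, hence projective,
    -- and it is generated by the countable set `T`.
    · set N := Submodule.span R S
      set W := (Submodule.span R (S ∪ T)).map N.mkQ with hW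
      have := projective_quotient_of_closed hs hS
      have h2 := projective_quotient_of_closed hs hST
      have : Module.Projective R ((M ⧸ N) ⧸ W) :=
        Module.Projective.of_equiv
          (Submodule.quotientQuotientEquivQuotient N (Submodule.span R (S ∪ T)) hle).symm
      have := projective_of_projective_quotient W
      obtain ⟨p, rfl⟩ := hTc.exists_eq_range ⟨m, hmT⟩
      have hp : ∀ k, N.mkQ (p k) ∈ W := fun k =>
        Submodule.mem_map_of_mem (Submodule.subset_span (Or.inr ⟨k, rfl⟩))
      refine h W (fun k => ⟨N.mkQ (p k), hp k⟩) ?_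
      have hW' : W = Submodule.span R (Set.range fun k => N.mkQ (p k)) := by
        rw [hW, Submodule.span_union, Submodule.map_sup, Submodule.mkQ_map_self, bot_sup_eq,
          Submodule.map_span, ← Set.range_comp]
        rfl
      apply Submodule.map_injective_of_injective W.injective_subtype
      rw [Submodule.map_span, Submodule.map_top, Submodule.range_subtype, ← Set.range_comp]
      exact hW'.symm

/-- The finitely generated right ideals of a von Neumann regular ring have left identities. -/
theorem exists_left_identity (hreg : ∀ a : R, ∃ b, a * b * a = a) {ι : Type*} (s : Finset ι)
    (a : ι → R) : ∃ h : ι → R, ∀ j ∈ s, (∑ i ∈ s, a i * h i) * a j = a j := by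
  classical
  induction s using Finset.induction_on with
  | empty => exact ⟨0, by simp⟩
  | insert k s hk ih =>
    obtain ⟨h, hh⟩ := ih
    set g := ∑ i ∈ s, a i * h i with hg
    -- The new left identity is `g + (1 - g) aₖ b (1 - g)`. It fixes `aₖ` by the choice of `b`, and
    -- the old `aⱼ` because `1 - g` kills them.
    obtain ⟨b, hb⟩ := hreg ((1 - g) * a k)
    refine ⟨fun i => if i = k then b * (1 - g) else h i - h i * a k * b * (1 - g), ?_⟩
    have e : ∑ i ∈ insert k s, a i * (if i = k then b * (1 - g) else
        h i - h i * a k * b * (1 - g)) = g + (1 - g) * a k * b * (1 - g) := by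
      rw [Finset.sum_insert hk, if_pos rfl]
      have : ∑ i ∈ s, a i * (if i = k then b * (1 - g) else h i - h i * a k * b * (1 - g)) =
          g - g * a k * b * (1 - g) := by
        rw [hg]
        simp only [Finset.sum_mul]
        rw [← hg, ← Finset.sum_sub_distrib]
        refine Finset.sum_congr rfl fun i hi => ?_
        have hik : i ≠ k := fun e => hk (e ▸ hi)
        rw [if_neg hik, mul_sub]
        simp only [mul_assoc]
      rw [this]
      noncomm_ring
    rw [e]
    intro j hj
    rcases Finset.mem_insert.mp hj with rfl | hj
    · rw [add_mul, mul_assoc _ (1 - g), hb]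
      noncomm_ring
    · rw [add_mul, hh j hj, mul_assoc _ (1 - g), sub_mul 1 g (a j), hh j hj, one_mul, sub_self, mul_zero,
        add_zero]

/-- Projective modules over von Neumann regular rings are regular modules. -/
theorem exists_regular_functional (hreg : ∀ a : R, ∃ b, a * b * a = a) {M : Type w}
    [AddCommGroup M] [Module R M] [hM : Module.Projective R M] (v : M) :
    ∃ h : M →ₗ[R] R, h v • v = v := by
  obtain ⟨s, hs⟩ := Module.projective_def'.mp hM
  have hs' : ∀ m, Finsupp.linearCombination R id (s m) = m := fun m => congrArg (fun f => f m) hs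
  obtain ⟨h, hh⟩ := exists_left_identity hreg (s v).support (s v)
  -- The value `f v = ∑ s(v)ᵢ hᵢ` is a left identity for the coordinates of `v` in a free module
  -- containing `M`.
  let f : M →ₗ[R] R := ∑ i ∈ (s v).support,
    (LinearMap.toSpanSingleton R R (h i)) ∘ₗ (Finsupp.lapply i) ∘ₗ s
  have hf : f v = ∑ i ∈ (s v).support, s v i * h i := by
    simp [f, LinearMap.sum_apply]
  refine ⟨f, ?_⟩
  have : f v • s v = s v := by
    ext i
    rw [Finsupp.smul_apply, smul_eq_mul, hf]
    by_cases hi : i ∈ (s v).support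
    · exact hh i hi
    · rw [Finsupp.notMem_support_iff.mp hi, mul_zero]
  calc f v • v = f v • Finsupp.linearCombination R id (s v) := by rw [hs']
    _ = v := by rw [← map_smul, this, hs']

/-- From `h v • v = v` it follows that `h` is injective on `R v`, so `R v ≅ R (h v)`. The map `x ↦ x
- h x • v` kills `v` and splits the quotient map. -/
theorem free_span_singleton (hreg : ∀ a : R, ∃ b, a * b * a = a)
    (hfree : ∀ a : R, Module.Free R (Submodule.span R {a})) {M : Type w}
    [AddCommGroup M] [Module R M] [Module.Projective R M] (v : M) :
    Module.Free R (Submodule.span R {v}) ∧ Module.Projective R (M ⧸ Submodule.span R {v}) := by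
  obtain ⟨h, hv⟩ := exists_regular_functional hreg v
  constructor
  · let f : Submodule.span R {v} →ₗ[R] Submodule.span R {h v} :=
      (h ∘ₗ (Submodule.span R {v}).subtype).codRestrict _ (by
        rintro ⟨x, hx⟩
        obtain ⟨c, rfl⟩ := Submodule.mem_span_singleton.mp hx
        exact Submodule.mem_span_singleton.mpr ⟨c, (h.map_smul c v).symm⟩)
    have hf : Function.Bijective f := by
      constructor
      · rw [injective_iff_map_eq_zero]
        rintro ⟨x, hx⟩ hx0
        obtain ⟨c, rfl⟩ := Submodule.mem_span_singleton.mp hx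
        have h0 : h (c • v) = 0 := congrArg Subtype.val hx0
        apply Subtype.ext
        show c • v = 0
        rw [← hv, ← mul_smul, ← smul_eq_mul, ← map_smul, h0, zero_smul]
      · rintro ⟨y, hy⟩
        obtain ⟨c, rfl⟩ := Submodule.mem_span_singleton.mp hy
        exact ⟨⟨c • v, Submodule.mem_span_singleton.mpr ⟨c, rfl⟩⟩, Subtype.ext (h.map_smul c v)⟩
    have := hfree (h v)
    exact Module.Free.of_equiv (LinearEquiv.ofBijective f hf).symm
  · refine Module.Projective.of_split ((Submodule.span R {v}).liftQ
      (LinearMap.id - (LinearMap.toSpanSingleton R M v) ∘ₗ h) ?_) (Submodule.span R {v}).mkQ ?_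
    · rw [Submodule.span_singleton_le_iff_mem, LinearMap.mem_ker]
      simp [hv]
    · apply Submodule.linearMap_qext
      ext x
      simp only [LinearMap.comp_apply, Submodule.mkQ_apply, Submodule.liftQ_apply,
        LinearMap.sub_apply, LinearMap.id_apply, LinearMap.toSpanSingleton_apply]
      rw [Submodule.Quotient.mk_sub, sub_eq_self]
      exact (Submodule.Quotient.mk_eq_zero _).mpr
        (Submodule.smul_mem _ _ (Submodule.mem_span_singleton_self v))

/-- In the filtration by the spans of the first `k` generators, each factor is a cyclic submodule of
the projective module `M / N k`, hence free, and the next quotient is again projective. -/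
theorem free_of_countably_generated (hreg : ∀ a : R, ∃ b, a * b * a = a)
    (hfree : ∀ a : R, Module.Free R (Submodule.span R {a})) {M : Type w}
    [AddCommGroup M] [Module R M] [hM : Module.Projective R M] (p : ℕ → M)
    (hp : Submodule.span R (Set.range p) = ⊤) : Module.Free R M := by
  classical
  let N : ℕ → Submodule R M := fun k => Submodule.span R (p '' Set.Iio k)
  have hmono : Monotone N := fun k l hkl =>
    Submodule.span_mono (Set.image_mono (Set.Iio_subset_Iio hkl))
  have hsucc : ∀ k, N (k + 1) = N k ⊔ Submodule.span R {p k} := by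
    intro k
    have : Set.Iio (k + 1) = Set.Iio k ∪ {k} := by ext; simp
    simp only [N, this, Set.image_union, Set.image_singleton, Submodule.span_union]
  have hmem : ∀ i k, i < k → p i ∈ N k := fun i k h => Submodule.subset_span ⟨i, h, rfl⟩
  have hN0 : N 0 = ⊥ := by simp [N]
  have hmap : ∀ k, (N (k + 1)).map (N k).mkQ = Submodule.span R {(N k).mkQ (p k)} := by
    intro k
    rw [hsucc, Submodule.map_sup, Submodule.mkQ_map_self, bot_sup_eq, Submodule.map_span,
      Set.image_singleton]
  have hproj : ∀ k, Module.Projective R (M ⧸ N k) := by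
    intro k
    induction k with
    | zero =>
      rw [hN0]
      exact Module.Projective.of_equiv (Submodule.quotEquivOfEqBot ⊥ rfl).symm
    | succ k ih =>
      have := (free_span_singleton hreg hfree ((N k).mkQ (p k))).2
      rw [← hmap] at this
      exact Module.Projective.of_equiv
        (Submodule.quotientQuotientEquivQuotient (N k) (N (k + 1)) (hmono k.le_succ))
  refine free_of_filtration (insert ⊤ (Set.range N)) (Or.inr ⟨0, hN0⟩) ?_ ?_
  · intro c hc _ hne
    -- A cofinal chain has supremum `⊤`; any other chain has only finitely many members and attains
    -- its supremum.
    by_cases htop : ∀ k, ∃ L ∈ c, N k ≤ L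
    · left
      rw [eq_top_iff, ← hp, Submodule.span_le]
      rintro _ ⟨i, rfl⟩
      obtain ⟨L, hL, hle⟩ := htop (i + 1)
      exact (le_sSup hL) (hle (hmem i _ i.lt_succ_self))
    · push Not at htop
      obtain ⟨k₀, hk₀⟩ := htop
      have hc' : ∀ L ∈ c, ∃ k, k ≤ k₀ ∧ N k = L := by
        intro L hL
        rcases hc hL with rfl | ⟨k, rfl⟩
        · exact (hk₀ _ hL le_top).elim
        · refine ⟨k, ?_, rfl⟩
          by_contra hlt
          exact hk₀ _ hL (hmono (by omega))
      obtain ⟨L₀, hL₀⟩ := hne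
      obtain ⟨k₁, hk₁, e⟩ := hc' L₀ hL₀
      have hg := Nat.findGreatest_spec (P := fun k => N k ∈ c) hk₁ (e ▸ hL₀)
      have : sSup c = N (Nat.findGreatest (fun k => N k ∈ c) k₀) := by
        refine le_antisymm (sSup_le fun L hL => ?_) (le_sSup hg)
        obtain ⟨k, hk, rfl⟩ := hc' L hL
        exact hmono (Nat.le_findGreatest hk hL)
      rw [this]
      exact Or.inr ⟨_, rfl⟩
  · intro L hL hLtop
    obtain ⟨k, rfl⟩ : ∃ k, N k = L := hL.resolve_left hLtop
    have hex : ∃ m, p m ∉ N k := by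
      by_contra! hall
      apply hLtop
      rw [eq_top_iff, ← hp, Submodule.span_le]
      rintro _ ⟨i, rfl⟩
      exact hall i
    -- The filtration may stall, so the step is taken at the first generator outside `N k`.
    have hm := Nat.find_spec hex
    have hm' : ∀ i < Nat.find hex, p i ∈ N k := fun i hi => not_not.mp (Nat.find_min hex hi)
    set m := Nat.find hex
    have hkm : k ≤ m := by
      by_contra hlt
      exact hm (hmem m k (by omega))
    have hNm : N k = N m := by
      refine le_antisymm (hmono hkm) (Submodule.span_le.mpr ?_)
      rintro _ ⟨i, hi, rfl⟩
      exact hm' i hi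
    rw [hNm] at hm ⊢
    refine ⟨N (m + 1), Or.inr ⟨_, rfl⟩, lt_of_le_of_ne (hmono m.le_succ) ?_, ?_⟩
    · intro e
      exact hm (e ▸ hmem m _ m.lt_succ_self)
    · rw [hmap]
      have := hproj m
      exact (free_span_singleton hreg hfree _).1

/-- If the principal left ideals of a von Neumann regular ring are free, then all projective left
modules are free. -/
theorem projectivesAreFree_of_regular (hreg : ∀ a : R, ∃ b, a * b * a = a)
    (hfree : ∀ a : R, Module.Free R (Submodule.span R {a})) : ProjectivesAreFree.{u, w} R :=
  projectivesAreFree_of_countable fun _ => free_of_countably_generated hreg hfree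

end Projectives

/-! ### Ranks of free modules over the localization -/

section Codimension

variable {K : Type u} [Field K]

/-- Codimensions add up for the image of a subspace under an injective map. -/
theorem rank_quotient_range_comp {G V W : Type u} [AddCommGroup G] [Module K G] [AddCommGroup V]
    [Module K V] [AddCommGroup W] [Module K W] (p : G →ₗ[K] V) (hp : Function.Injective p)
    (g : W →ₗ[K] G) :
    Module.rank K (V ⧸ LinearMap.range (p ∘ₗ g)) =
      Module.rank K (V ⧸ LinearMap.range p) + Module.rank K (G ⧸ LinearMap.range g) := by
  set U := LinearMap.range (p ∘ₗ g) with hU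
  have hle : U ≤ LinearMap.range p := LinearMap.range_comp_le_range g p
  rw [← Submodule.rank_quotient_add_rank ((LinearMap.range p).map U.mkQ)]
  congr 1
  · exact (Submodule.quotientQuotientEquivQuotient U (LinearMap.range p) hle).rank_eq
  · rw [← LinearMap.range_comp]
    have hker : LinearMap.ker (U.mkQ ∘ₗ p) = LinearMap.range g := by
      rw [LinearMap.ker_comp, Submodule.ker_mkQ, hU, LinearMap.range_comp,
        Submodule.comap_map_eq_of_injective hp]
    rw [← (LinearMap.quotKerEquivRange (U.mkQ ∘ₗ p)).rank_eq]
    exact (Submodule.quotEquivOfEq _ _ hker).rank_eq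

theorem rank_quotient_range_compLeft {G V : Type u} [AddCommGroup G] [Module K G]
    [AddCommGroup V] [Module K V] (p : G →ₗ[K] V) (n : ℕ) :
    Module.rank K ((Fin n → V) ⧸ LinearMap.range (p.compLeft (Fin n))) =
      n * Module.rank K (V ⧸ LinearMap.range p) := by
  have h : LinearMap.range (p.compLeft (Fin n)) =
      Submodule.pi Set.univ fun _ : Fin n => LinearMap.range p := by
    ext f
    constructor
    · rintro ⟨g, rfl⟩ i _
      exact ⟨g i, rfl⟩
    · intro hf
      choose g hg using fun i => hf i trivial
      exact ⟨g, funext hg⟩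
  rw [h, (Submodule.quotientPi fun _ : Fin n => LinearMap.range p).rank_eq,
    rank_fun_eq_lift_mul]
  rw [Fintype.card_fin, Cardinal.lift_uzero]

/-- The operator `f ↦ ∑ rᵢ (fᵢ)`. -/
def sumOp {V : Type u} [AddCommGroup V] [Module K V] {n : ℕ} (r : Fin n → V →ₗ[K] V) :
    (Fin n → V) →ₗ[K] V :=
  ∑ i, r i ∘ₗ LinearMap.proj i

theorem sumOp_apply {V : Type u} [AddCommGroup V] [Module K V] {n : ℕ} (r : Fin n → V →ₗ[K] V)
    (f : Fin n → V) : sumOp r f = ∑ i, r i (f i) := by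
  simp [sumOp, LinearMap.sum_apply]

/-- A Schreier formula. -/
theorem rank_quotient_sumOp {G V : Type u} [AddCommGroup G] [Module K G] [AddCommGroup V]
    [Module K V] {n : ℕ} (r : Fin n → V →ₗ[K] V) (s : Fin n → G →ₗ[K] G)
    (hr : Function.Injective (sumOp r)) (p : G →ₗ[K] V) (hp : Function.Injective p)
    (hrs : ∀ i x, p (s i x) = r i (p x)) :
    Module.rank K (V ⧸ LinearMap.range p) + Module.rank K (G ⧸ LinearMap.range (sumOp s)) =
      Module.rank K (V ⧸ LinearMap.range (sumOp r)) +
        n * Module.rank K (V ⧸ LinearMap.range p) := by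
  -- The formula computes the codimension of the image of this one map in two ways.
  have h : p ∘ₗ sumOp s = sumOp r ∘ₗ p.compLeft (Fin n) := by
    refine LinearMap.ext fun f => ?_
    simp only [LinearMap.comp_apply, sumOp_apply, map_sum, hrs]
    rfl
  rw [← rank_quotient_range_comp p hp, h, rank_quotient_range_comp _ hr,
    rank_quotient_range_compLeft]

end Codimension

/-! ### Ranks of free modules modulo `n - 1` -/

section RankCongruence

variable {K : Type u} [Field K] {n : ℕ}

/-- Multiplication by a generator on the right. -/
noncomputable def mulGen (K : Type u) [Field K] {n : ℕ} (h : ℕ) (i : Fin n) :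
    (Fin h → FreeAlgebra K (Fin n)) →ₗ[K] (Fin h → FreeAlgebra K (Fin n)) :=
  (LinearMap.mulRight K (FreeAlgebra.ι K i)).compLeft (Fin h)

theorem mulGen_apply (h : ℕ) (i : Fin n) (v : Fin h → FreeAlgebra K (Fin n)) (j : Fin h) :
    mulGen K h i v j = v j * FreeAlgebra.ι K i := rfl

theorem sumOp_mulGen_injective (h : ℕ) :
    Function.Injective (sumOp (mulGen K (n := n) h)) := by
  rw [injective_iff_map_eq_zero]
  intro f hf
  ext i j
  have := congrFun hf j
  rw [sumOp_apply, Finset.sum_apply] at this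
  exact eq_zero_of_sum_mul_ι_eq_zero (f := fun i => f i j) this i

/-- The image consists of the vectors whose entries have constant term 0, so the quotient is `Kʰ`.
-/
theorem rank_quotient_sumOp_mulGen (h : ℕ) :
    Module.rank K ((Fin h → FreeAlgebra K (Fin n)) ⧸
      LinearMap.range (sumOp (mulGen K (n := n) h))) = h := by
  let ε : (Fin h → FreeAlgebra K (Fin n)) →ₗ[K] (Fin h → K) :=
    (FreeAlgebra.algebraMapInv (R := K) (X := Fin n)).toLinearMap.compLeft (Fin h)
  have hε : Function.Surjective ε := fun c =>
    ⟨fun j => algebraMap K _ (c j), funext fun j => FreeAlgebra.algebraMap_leftInverse (c j)⟩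
  have hker : LinearMap.ker ε = LinearMap.range (sumOp (mulGen K (n := n) h)) := by
    ext v
    constructor
    · intro hv
      choose f hf using fun j => exists_eq_add_sum_mul_ι (v j)
      refine ⟨fun i j => f j i, ?_⟩
      ext j
      rw [sumOp_apply, Finset.sum_apply]
      have h0 : FreeAlgebra.algebraMapInv (v j) = 0 := congrFun hv j
      rw [hf j, h0, map_zero, zero_add]
      rfl
    · rintro ⟨f, rfl⟩
      rw [LinearMap.mem_ker]
      ext j
      show FreeAlgebra.algebraMapInv (sumOp _ f j) = 0
      rw [sumOp_apply, Finset.sum_apply, map_sum]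
      refine Finset.sum_eq_zero fun i _ => ?_
      rw [mulGen_apply, map_mul]
      simp [FreeAlgebra.algebraMapInv]
  rw [← hker, (LinearMap.quotKerEquivOfSurjective ε hε).rank_eq, rank_fin_fun]

/-- Pairs `(v, w)` of vectors over the free algebra with `X v = w` over the localization. -/
def graphSubmodule {h k : ℕ} (X : Fin k → Fin h → Qfc K n) :
    Submodule K ((Fin h → FreeAlgebra K (Fin n)) × (Fin k → FreeAlgebra K (Fin n))) where
  carrier := {p | ∀ a, ∑ j, X a j * toQfc K n (p.1 j) = toQfc K n (p.2 a)}
  add_mem' := by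
    intro p q hp hq a
    simp only [Prod.fst_add, Prod.snd_add, Pi.add_apply, map_add, mul_add,
      Finset.sum_add_distrib]
    rw [hp a, hq a]
  zero_mem' := by
    intro a
    simp
  smul_mem' := by
    intro c p hp a
    -- A scalar is moved to the right, where it passes through the defining equations.
    have h : ∀ x : FreeAlgebra K (Fin n),
        toQfc K n (c • x) = toQfc K n x * toQfc K n (algebraMap K _ c) := fun x => by
      rw [Algebra.smul_def, Algebra.commutes, map_mul]
    simp only [Prod.smul_fst, Prod.smul_snd, Pi.smul_apply, h, ← mul_assoc]
    rw [← Finset.sum_mul, hp a]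

/-- Multiplication by a generator on the graph. -/
noncomputable def graphMulGen {h k : ℕ} (X : Fin k → Fin h → Qfc K n) (i : Fin n) :
    graphSubmodule X →ₗ[K] graphSubmodule X :=
  ((mulGen K h i).prodMap (mulGen K k i)).restrict fun p hp a => by
    simp only [LinearMap.prodMap_apply, mulGen_apply, map_mul, ← mul_assoc]
    rw [← Finset.sum_mul, hp a]

/-- Vectors over the free algebra with entries in a finite codimensional right ideal have finite
codimension. -/
theorem rank_quotient_lt_aleph0 {h : ℕ} {J : Ideal (FreeAlgebra K (Fin n))ᵐᵒᵖ}
    (hJ : J ∈ fcFilter K (FreeAlgebra K (Fin n))) {U : Submodule K (Fin h → FreeAlgebra K (Fin n))}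
    (hU : ∀ v : Fin h → FreeAlgebra K (Fin n), (∀ j, op (v j) ∈ J) → v ∈ U) :
    Module.rank K ((Fin h → FreeAlgebra K (Fin n)) ⧸ U) < Cardinal.aleph0 := by
  rw [mem_fcFilter] at hJ
  have : Module.Finite K ((FreeAlgebra K (Fin n))ᵐᵒᵖ ⧸ J.restrictScalars K) := hJ
  let f : (Fin h → FreeAlgebra K (Fin n)) →ₗ[K]
      (Fin h → (FreeAlgebra K (Fin n))ᵐᵒᵖ ⧸ J.restrictScalars K) :=
    ((J.restrictScalars K).mkQ ∘ₗ (opLinearEquiv K).toLinearMap).compLeft (Fin h)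
  have hker : LinearMap.ker f ≤ U := by
    intro v hv
    refine hU v fun j => ?_
    exact (Submodule.Quotient.mk_eq_zero (J.restrictScalars K)).mp (congrFun hv j)
  have h1 : Module.Finite K ((Fin h → FreeAlgebra K (Fin n)) ⧸ LinearMap.ker f) :=
    Module.Finite.equiv (LinearMap.quotKerEquivRange f).symm
  have h2 : Module.Finite K ((Fin h → FreeAlgebra K (Fin n)) ⧸ U) :=
    Module.Finite.of_surjective (Submodule.factor hker) (Submodule.factor_surjective hker)
  exact Module.rank_lt_aleph0 K _

theorem finset_inf_mem {A : Type u} [Ring A] {F : IdealFilter Aᵐᵒᵖ} {ι : Type*} (s : Finset ι)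
    {I : ι → Ideal Aᵐᵒᵖ} (h : ∀ i, I i ∈ F) : s.inf I ∈ F := by
  classical
  induction s using Finset.induction_on with
  | empty => exact Order.PFilter.top_mem
  | insert i s hi ih => rw [Finset.inf_insert]; exact Order.PFilter.inf_mem (h _) ih

/-- A common denominator: a finite codimensional right ideal carried into the free algebra. -/
theorem exists_common_numerators {h k : ℕ} (X : Fin k → Fin h → Qfc K n) :
    ∃ J ∈ fcFilter K (FreeAlgebra K (Fin n)), ∀ v : Fin h → FreeAlgebra K (Fin n),
      (∀ j, op (v j) ∈ J) → ∃ w : Fin k → FreeAlgebra K (Fin n),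
        ∀ a, ∑ j, X a j * toQfc K n (v j) = toQfc K n (w a) := by
  refine ⟨Finset.univ.inf fun p : Fin k × Fin h => numerators (toQfc K n) (X p.1 p.2),
    finset_inf_mem _ fun p => RightQuotients.numerators_mem _, fun v hv => ?_⟩
  have : ∀ a j, ∃ z, X a j * toQfc K n (v j) = toQfc K n z := fun a j =>
    Finset.inf_le (f := fun p : Fin k × Fin h => numerators (toQfc K n) (X p.1 p.2))
      (Finset.mem_univ (a, j)) (hv j)
  choose z hz using this
  exact ⟨fun a => ∑ j, z a j, fun a => by rw [map_sum]; exact Finset.sum_congr rfl fun j _ => hz a j⟩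

/-- Invertible matrices over the localization have sizes congruent modulo `n - 1`. -/
theorem natCast_eq_of_inverse (hn : 1 ≤ n) {h k : ℕ} {X : Fin k → Fin h → Qfc K n}
    {Y : Fin h → Fin k → Qfc K n}
    (hXY : ∀ a b, ∑ j, X a j * Y j b = if a = b then 1 else 0)
    (hYX : ∀ i j, ∑ a, Y i a * X a j = if i = j then 1 else 0) :
    (h : ZMod (n - 1)) = k := by
  have hinj := RightQuotients.ofRing_injective (isFaithfulFilter_fcFilter (K := K) hn)
  let G := graphSubmodule X
  have hY : ∀ p : (Fin h → FreeAlgebra K (Fin n)) × (Fin k → FreeAlgebra K (Fin n)), p ∈ G →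
      ∀ i, toQfc K n (p.1 i) = ∑ a, Y i a * toQfc K n (p.2 a) := by
    intro p hp i
    simp only [← hp _, Finset.mul_sum, ← mul_assoc]
    rw [Finset.sum_comm]
    simp only [← Finset.sum_mul, hYX]
    simp
  let p₁ : G →ₗ[K] (Fin h → FreeAlgebra K (Fin n)) := LinearMap.fst K _ _ ∘ₗ G.subtype
  let p₂ : G →ₗ[K] (Fin k → FreeAlgebra K (Fin n)) := LinearMap.snd K _ _ ∘ₗ G.subtype
  have hp₁ : Function.Injective p₁ := by
    rw [injective_iff_map_eq_zero]
    rintro ⟨⟨v, w⟩, hvw⟩ (h0 : v = 0)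
    subst h0
    refine Subtype.ext (Prod.ext rfl (funext fun a => hinj ?_))
    have := hvw a
    simp only [Pi.zero_apply, map_zero, mul_zero, Finset.sum_const_zero] at this
    exact this.symm.trans (map_zero _).symm
  have hp₂ : Function.Injective p₂ := by
    rw [injective_iff_map_eq_zero]
    rintro ⟨⟨v, w⟩, hvw⟩ (h0 : w = 0)
    subst h0
    refine Subtype.ext (Prod.ext (funext fun a => hinj ?_) rfl)
    have := hY _ hvw a
    simp only [Pi.zero_apply, map_zero, mul_zero, Finset.sum_const_zero] at this
    exact this.trans (map_zero _).symm
  -- The same `G` is compared with `Aʰ` and with `Aᵏ`; the term `dim (G / ∑ G aᵢ)` is common to both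
  -- equations.
  have e₁ := rank_quotient_sumOp (mulGen K (n := n) h) (graphMulGen X)
    (sumOp_mulGen_injective h) p₁ hp₁ fun i x => rfl
  have e₂ := rank_quotient_sumOp (mulGen K (n := n) k) (graphMulGen X)
    (sumOp_mulGen_injective k) p₂ hp₂ fun i x => rfl
  rw [rank_quotient_sumOp_mulGen] at e₁ e₂
  obtain ⟨J₁, hJ₁, hX⟩ := exists_common_numerators X
  obtain ⟨J₂, hJ₂, hY'⟩ := exists_common_numerators Y
  have f₁ := rank_quotient_lt_aleph0 (U := LinearMap.range p₁) hJ₁ fun v hv => by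
    obtain ⟨w, hw⟩ := hX v hv
    exact ⟨⟨(v, w), hw⟩, rfl⟩
  have f₂ := rank_quotient_lt_aleph0 (U := LinearMap.range p₂) hJ₂ fun w hw => by
    obtain ⟨v, hv⟩ := hY' w hw
    refine ⟨⟨(v, w), fun a => ?_⟩, rfl⟩
    show ∑ j, X a j * toQfc K n (v j) = toQfc K n (w a)
    simp only [← hv, Finset.mul_sum, ← mul_assoc]
    rw [Finset.sum_comm]
    simp only [← Finset.sum_mul, hXY]
    simp
  obtain ⟨d₁, hd₁⟩ := Cardinal.lt_aleph0.mp f₁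
  obtain ⟨d₂, hd₂⟩ := Cardinal.lt_aleph0.mp f₂
  rw [hd₁] at e₁
  rw [hd₂] at e₂
  have f : Module.rank K (G ⧸ LinearMap.range (sumOp (graphMulGen X))) < Cardinal.aleph0 := by
    refine lt_of_le_of_lt (self_le_add_left _ _) (e₁.trans_lt ?_)
    exact_mod_cast Cardinal.natCast_lt_aleph0 (n := h + n * d₁)
  obtain ⟨γ, hγ⟩ := Cardinal.lt_aleph0.mp f
  rw [hγ] at e₁ e₂
  have e₁' : d₁ + γ = h + n * d₁ := by exact_mod_cast e₁
  have e₂' : d₂ + γ = k + n * d₂ := by exact_mod_cast e₂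
  -- As `n = 1` here, `d₁` and `d₂` cancel, and both `h` and `k` equal `γ`. For `n = 1` the ring is
  -- `ZMod 0 = ℤ`.
  have hn1 : (n : ZMod (n - 1)) = 1 := by
    have : ((n - 1 + 1 : ℕ) : ZMod (n - 1)) = 1 := by simp
    rwa [Nat.sub_add_cancel hn] at this
  have c₁ := congrArg (Nat.cast (R := ZMod (n - 1))) e₁'
  have c₂ := congrArg (Nat.cast (R := ZMod (n - 1))) e₂'
  push_cast [hn1] at c₁ c₂
  rw [one_mul, add_comm] at c₁ c₂
  exact (add_right_cancel c₁).symm.trans (add_right_cancel c₂)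

/-- The matrix entries are `unop` of the coordinates, which turns composition of maps over `Qᵐᵒᵖ`
into the ordinary matrix product over `Q`. -/
theorem natCast_eq_of_linearEquiv (hn : 1 ≤ n) {h k : ℕ}
    (θ : (Fin h → (Qfc K n)ᵐᵒᵖ) ≃ₗ[(Qfc K n)ᵐᵒᵖ] (Fin k → (Qfc K n)ᵐᵒᵖ)) :
    (h : ZMod (n - 1)) = k := by
  have key : ∀ (h k : ℕ) (θ : (Fin h → (Qfc K n)ᵐᵒᵖ) ≃ₗ[(Qfc K n)ᵐᵒᵖ] (Fin k → (Qfc K n)ᵐᵒᵖ))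
      (a b : Fin k), ∑ j, (θ (Pi.single j 1) a).unop * (θ.symm (Pi.single b 1) j).unop =
        if a = b then 1 else 0 := by
    intro h k θ a b
    have h1 : θ.symm (Pi.single b 1) =
        ∑ j, θ.symm (Pi.single b 1) j • (Pi.single j 1 : Fin h → (Qfc K n)ᵐᵒᵖ) := by
      ext j
      simp [Finset.sum_apply, Pi.single_apply]
    have h2 := congrArg θ h1
    rw [LinearEquiv.apply_symm_apply, map_sum] at h2
    have h3 := congrArg unop (congrFun h2 a)
    rw [Finset.sum_apply, Finset.unop_sum] at h3
    simp only [map_smul, Pi.smul_apply, smul_eq_mul, unop_mul] at h3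
    rw [← h3, Pi.single_apply]
    split_ifs <;> simp
  exact natCast_eq_of_inverse hn (X := fun a j => (θ (Pi.single j 1) a).unop)
    (Y := fun j b => (θ.symm (Pi.single b 1) j).unop) (key h k θ) (key k h θ.symm)

/-- The localization is isomorphic to its `n`-th power as a right module. -/
theorem nonempty_linearEquiv_pow (hn : 1 ≤ n) :
    Nonempty ((Fin 1 → (Qfc K n)ᵐᵒᵖ) ≃ₗ[(Qfc K n)ᵐᵒᵖ] (Fin n → (Qfc K n)ᵐᵒᵖ)) := by
  have hli : LinearIndependent (FreeAlgebra K (Fin n))ᵐᵒᵖ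
      (FreeAlgebra.ι K : Fin n → FreeAlgebra K (Fin n)) :=
    linearIndependent_of_isLead isLead_ι fun i j a b h => by
      have h' : i :: a.toList = j :: b.toList := congrArg FreeMonoid.toList h
      exact (List.cons.inj h').1
  have hJ : toIdealOp (Submodule.span (FreeAlgebra K (Fin n))ᵐᵒᵖ
      (Set.range (FreeAlgebra.ι K : Fin n → FreeAlgebra K (Fin n)))) ∈
        fcFilter K (FreeAlgebra K (Fin n)) := by
    -- Every nonempty word begins with a generator, so the generators span a right ideal with
    -- complement `K · 1`.
    refine toIdealOp_mem_fcFilter (Submodule.span K {1}) (Submodule.fg_span_singleton _)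
      (le_of_isLead fun t _ w _ => ?_)
    rcases hw : w.toList with _ | ⟨i, l⟩
    · refine ⟨wmon K w, Submodule.mem_sup_right ?_, trivial, isLead_wmon w⟩
      have : w = 1 := FreeMonoid.toList.injective hw
      have h1 : wmon K w = (1 : FreeAlgebra K (Fin n)) := by
        rw [this, wmon, AlgEquiv.symm_apply_eq, map_one]
        rfl
      rw [h1]
      exact Submodule.mem_span_singleton_self _
    · refine ⟨FreeAlgebra.ι K i * wmon K (FreeMonoid.ofList l), Submodule.mem_sup_left ?_, trivial,
        ?_⟩
      · exact Submodule.smul_mem _ (op (wmon K _)) (Submodule.subset_span ⟨i, rfl⟩)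
      · have : w = FreeMonoid.of i * FreeMonoid.ofList l := FreeMonoid.toList.injective hw
        rw [this]
        exact (isLead_ι i).mul (isLead_wmon _)
  obtain ⟨y, hy, hy1⟩ := exists_dual_basis hn hli hJ
  refine ⟨{
    toFun := fun v i => v 0 * op (y i)
    invFun := fun w _ => ∑ i, w i * op (toQfc K n (FreeAlgebra.ι K i))
    map_add' := fun v w => by ext i; simp [add_mul]
    map_smul' := fun c v => by ext i; simp [mul_assoc]
    left_inv := fun v => ?_
    right_inv := fun w => ?_ }⟩
  · ext j
    rw [Subsingleton.elim j 0]
    simp only [mul_assoc, ← op_mul, ← Finset.mul_sum]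
    rw [← Finset.op_sum, hy1, op_one, mul_one]
  · ext i
    change (∑ i', w i' * op (toQfc K n (FreeAlgebra.ι K i'))) * op (y i) = w i
    rw [Finset.sum_mul]
    refine (Finset.sum_congr rfl fun j _ => ?_).trans (Finset.sum_ite_eq _ i w |>.trans (if_pos (Finset.mem_univ i)))
    rw [mul_assoc, ← op_mul, hy i j]
    split_ifs <;> simp

end RankCongruence

/-! ### The Grothendieck group -/

section Grothendieck

variable {R : Type u} [Ring R]

/-- The class of a finitely generated projective module in the Grothendieck group. -/
def K0.of (P : FGProj R) : K0 R :=
  QuotientAddGroup.mk (FreeAbelianGroup.of P)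

theorem K0.of_eq_add {P P₁ P₂ : FGProj R} (e : P.carrier ≃ₗ[R] P₁.carrier × P₂.carrier) :
    K0.of P = K0.of P₁ + K0.of P₂ := by
  rw [K0.of, K0.of, K0.of, ← QuotientAddGroup.mk_add, ← sub_eq_zero, ← QuotientAddGroup.mk_sub,
    QuotientAddGroup.eq_zero_iff]
  exact AddSubgroup.subset_closure ⟨P, P₁, P₂, ⟨e⟩, rfl⟩

variable (R) in
/-- The free module of rank `k`. -/
abbrev FGProj.free (k : ℕ) : FGProj R where
  carrier := Fin k → R

/-- The canonical isomorphism between `Rʰ⁺ᵏ` and `Rʰ × Rᵏ`. -/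
def finAddLinearEquiv (h k : ℕ) : (Fin (h + k) → R) ≃ₗ[R] (Fin h → R) × (Fin k → R) :=
  (LinearEquiv.funCongrLeft R R finSumFinEquiv).trans
    (LinearEquiv.sumArrowLequivProdArrow (Fin h) (Fin k) R R)

theorem K0.of_free_add (h k : ℕ) :
    K0.of (FGProj.free R (h + k)) = K0.of (FGProj.free R h) + K0.of (FGProj.free R k) :=
  K0.of_eq_add (finAddLinearEquiv h k)

theorem K0.of_free_zero : K0.of (FGProj.free R 0) = 0 := by
  simpa using K0.of_free_add (R := R) 0 0

/-- The relations speak only of direct sums, so an isomorphism is read as `P ≅ P' × R⁰`. -/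
theorem K0.of_eq_of_linearEquiv {P P' : FGProj R} (e : P.carrier ≃ₗ[R] P'.carrier) :
    K0.of P = K0.of P' := by
  rw [← add_zero (K0.of P'), ← K0.of_free_zero]
  exact K0.of_eq_add (e.trans (LinearEquiv.prodUnique (R := R) (M := P'.carrier)
    (M₂ := Fin 0 → R)).symm)

theorem K0.of_free (k : ℕ) : K0.of (FGProj.free R k) = k • K0.of (FGProj.free R 1) := by
  induction k with
  | zero => rw [K0.of_free_zero, zero_smul]
  | succ k ih => rw [K0.of_free_add, ih, succ_nsmul]

/-- If all finitely generated projective modules are free and the isomorphisms between free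
modules are those forced by `R ≅ R ^ (m + 1)`, then the Grothendieck group is `ℤ / m`. -/
theorem nonempty_K0_addEquiv [Nontrivial R] {m : ℕ} (hfree : ProjectivesAreFree.{u, u} R)
    (hrank : ∀ h k : ℕ, ((Fin h → R) ≃ₗ[R] (Fin k → R)) → (h : ZMod m) = k)
    (hpow : Nonempty ((Fin 1 → R) ≃ₗ[R] (Fin (m + 1) → R))) : Nonempty (K0 R ≃+ ZMod m) := by
  have hex : ∀ P : FGProj R, ∃ k : ℕ, Nonempty (P.carrier ≃ₗ[R] (Fin k → R)) := fun P => by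
    have := hfree P.carrier P.projective
    let b := Module.Free.chooseBasis R P.carrier
    have : Finite (Module.Free.ChooseBasisIndex R P.carrier) := Module.Finite.finite_basis b
    obtain ⟨k, ⟨e⟩⟩ := Finite.exists_equiv_fin (Module.Free.ChooseBasisIndex R P.carrier)
    exact ⟨k, ⟨(b.reindex e).equivFun⟩⟩
  choose r hr using hex
  -- The rank `r P` is a choice, well defined modulo `m` by `hrank`, hence additive there.
  let F : K0 R →+ ZMod m := QuotientAddGroup.lift _
    (FreeAbelianGroup.lift fun P => (r P : ZMod m)) <| by
      refine (AddSubgroup.closure_le _).mpr ?_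
      rintro _ ⟨P, P₁, P₂, ⟨e⟩, rfl⟩
      have key := hrank (r P) (r P₁ + r P₂) ((hr P).some.symm.trans <| e.trans <|
        ((hr P₁).some.prodCongr (hr P₂).some).trans (finAddLinearEquiv _ _).symm)
      push_cast at key
      simp [key]
  have hF : ∀ P, F (K0.of P) = r P := fun P => FreeAbelianGroup.lift_apply_of _ _
  have hm : m • K0.of (FGProj.free R 1) = 0 := by
    have := K0.of_eq_of_linearEquiv (P := FGProj.free R 1) (P' := FGProj.free R (m + 1)) hpow.some
    rw [K0.of_free (m + 1), succ_nsmul] at this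
    exact right_eq_add.mp (by rwa [add_comm] at this)
  -- The inverse sends 1 to the class of `R`, which is killed by `m` because `R ≅ R ^ (m + 1)`.
  let G : ZMod m →+ K0 R := ZMod.lift m ⟨zmultiplesHom _ (K0.of (FGProj.free R 1)),
    by simpa using hm⟩
  have hG : ∀ k : ℕ, G k = k • K0.of (FGProj.free R 1) := fun k => by
    have := ZMod.lift_coe m ⟨zmultiplesHom (K0 R) (K0.of (FGProj.free R 1)),
      by simpa using hm⟩ (k : ℤ)
    simpa using this
  have hGF : ∀ z, G (F z) = z := by
    have : G.comp F = AddMonoidHom.id _ := by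
      refine QuotientAddGroup.addMonoidHom_ext _ (FreeAbelianGroup.lift_ext _ _ fun P => ?_)
      change G (F (K0.of P)) = K0.of P
      rw [hF, hG, ← K0.of_free]
      exact (K0.of_eq_of_linearEquiv (P' := FGProj.free R (r P)) (hr P).some).symm
    exact DFunLike.congr_fun this
  refine ⟨AddEquiv.ofBijective F ⟨Function.LeftInverse.injective hGF, fun z => ?_⟩⟩
  obtain ⟨k, rfl⟩ := ZMod.intCast_surjective z
  refine ⟨k • K0.of (FGProj.free R 1), ?_⟩
  rw [map_zsmul, hF, ← hrank 1 (r (FGProj.free R 1)) (hr (FGProj.free R 1)).some]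
  simp

end Grothendieck

/-! ### Freeness, module type and `K₀` of the fc-localization -/

section Main

variable {K : Type u} [Field K] {n : ℕ}

theorem projectivesAreFree_Qfc (hn : 1 ≤ n) : ProjectivesAreFree.{u, w} (Qfc K n) :=
  projectivesAreFree_of_regular (exists_regular_Qfc hn) (free_left_span_Qfc hn)

theorem projectivesAreFree_op_Qfc (hn : 1 ≤ n) : ProjectivesAreFree.{u, w} (Qfc K n)ᵐᵒᵖ := by
  refine projectivesAreFree_of_regular (fun a => ?_) (free_right_span_Qfc hn)
  obtain ⟨p, hp⟩ := exists_regular_Qfc hn a.unop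
  exact ⟨op p, unop_injective (by rw [unop_mul, unop_mul, unop_op, ← mul_assoc, hp])⟩

theorem nonempty_K0_Qfc_addEquiv (hn : 1 ≤ n) : Nonempty (K0 (Qfc K n)ᵐᵒᵖ ≃+ ZMod (n - 1)) := by
  have := isSimpleRing_Qfc (K := K) hn
  refine nonempty_K0_addEquiv (projectivesAreFree_op_Qfc hn)
    (fun h k θ => natCast_eq_of_linearEquiv hn θ) ?_
  rw [Nat.sub_add_cancel hn]
  exact nonempty_linearEquiv_pow hn

/-- From `h ≡ k` modulo `n - 1` and `1 ≤ h < k` follows `k ≥ h + (n - 1) ≥ n`. -/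
theorem hasModuleType_Qfc (hn : 1 < n) : HasModuleType (Qfc K n)ᵐᵒᵖ 1 n := by
  refine ⟨le_rfl, hn, nonempty_linearEquiv_pow hn.le, fun h k hh hk ⟨θ⟩ => ⟨hh, ?_⟩⟩
  have h1 := (ZMod.natCast_eq_natCast_iff h k (n - 1)).mp (natCast_eq_of_linearEquiv hn.le θ)
  have h2 := Nat.le_of_dvd (by omega) ((Nat.modEq_iff_dvd' hk.le).mp h1)
  omega

theorem invariantBasisNumber_Qfc_one : InvariantBasisNumber (Qfc K 1)ᵐᵒᵖ where
  eq_of_fin_equiv {h k} θ := by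
    have : ((h : ℕ) : ZMod 0) = k := natCast_eq_of_linearEquiv le_rfl θ
    exact Int.ofNat_inj.mp this

end Main

end RightLoc

open RightLoc

theorem theorem3p6 (K : Type u) [Field K] (n : ℕ) (hn : 1 ≤ n) :
    -- the fc-localization is a perfect localization, and contains the free algebra
    IsFlatBimorphism (toQfc K n) ∧
    -- it is the largest flat bimorphic ring of right quotients: every flat bimorphism out of
    -- the free algebra embeds uniquely into it, and as a subring of `Q_max` it is `Q_tot`
    (∀ (B : Type v) [Ring B] (ψ : FreeAlgebra K (Fin n) →+* B), IsFlatBimorphism ψ →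
      ∃ h : B →+* Qfc K n, Function.Injective h ∧ h.comp ψ = toQfc K n ∧
        ∀ h' : B →+* Qfc K n, h'.comp ψ = toQfc K n → h' = h) ∧
    (∃ j : Qfc K n →+* Qmax (FreeAlgebra K (Fin n)), Function.Injective j ∧
      j.comp (toQfc K n) = toQmax (FreeAlgebra K (Fin n)) ∧
      IsQtot (FreeAlgebra K (Fin n)) j.range) ∧
    IsSimpleRing (Qfc K n) ∧
    -- projective-free, for right and for left modules
    ProjectivesAreFree.{u, w} (Qfc K n)ᵐᵒᵖ ∧
    ProjectivesAreFree.{u, w} (Qfc K n) ∧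
    (n = 1 → InvariantBasisNumber (Qfc K n)ᵐᵒᵖ ∧ Nonempty (K0 (Qfc K n)ᵐᵒᵖ ≃+ ℤ)) ∧
    (1 < n → HasModuleType (Qfc K n)ᵐᵒᵖ 1 n ∧
      Nonempty (K0 (Qfc K n)ᵐᵒᵖ ≃+ ZMod (n - 1))) := by
  refine ⟨isFlatBimorphism_toQfc hn, fun B _ ψ hψ => exists_lift_of_isFlatBimorphism hn hψ,
    exists_isQtot hn, isSimpleRing_Qfc hn, projectivesAreFree_op_Qfc hn, projectivesAreFree_Qfc hn,
    ?_, fun h1 => ⟨hasModuleType_Qfc h1, nonempty_K0_Qfc_addEquiv hn⟩⟩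
  rintro rfl
  -- `ZMod (1 - 1)` is `ℤ` by definition.
  exact ⟨invariantBasisNumber_Qfc_one, nonempty_K0_Qfc_addEquiv le_rfl⟩
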